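/- Let $\mathbb{K}$ be a field, $\ell\ge 0$ an integer, and $Q$ the quiver of type $\mathbb{A}_\ell$ with vertices $x_0,\dots,x_\ell$ and orientation $\tau=(\tau_1,\dots,\tau_\ell)\in\{0,1\}^\ell$: for each $1\le i\le \ell$ there is exactly one arrow $e_i$ between $x_{i-1}$ and $x_i$, namely $x_{i-1}\to x_i$ if $\tau_i=1$ and $x_i\to x_{i-1}$ if $\tau_i=0$. Let $\mathbf{Rep}(Q)$ be the category of finite-dimensional representations of $Q$ over $\mathbb{K}$. A central charge is a function $\alpha:\{x_0,\dots,x_\ell\}\to\mathbb{R}$. The $\alpha$-slope of a representation $V\ne 0$ is $\mu_\alpha(V)=\frac{\sum_i\alpha(x_i)\dim V_{x_i}}{\sum_i\dim V_{x_i}}$, and $V\neq 0$ is $\alpha$-semistable if $\mu_\alpha(U)\le\mu_\alpha(V)$ for every subrepresentation $0\ne U\subset V$. The Harder-Narasimhan (HN) type of $V$ along $\alpha$ is the list $(\underline{\dim}\,S^1,\dots,\underline{\dim}\,S^n)$ of the dimension vectors of the successive quotients $S^i=V^i/V^{i-1}$ of the unique filtration $0=V^0\subsetneq V^1\subsetneq\dots\subsetneq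 V^n=V$ by subrepresentations whose successive quotients are $\alpha$-semistable with $\mu_\alpha(S^1)>\dots>\mu_\alpha(S^n)$ (the empty list for $V=0$). The central charge $\alpha$ is complete for $Q$ if any two representations in $\mathbf{Rep}(Q)$ with the same HN type along $\alpha$ are isomorphic. For $0\le a\le b\le\ell$ let $\mathbf{I}_\tau[a,b]$ be the interval module, which is $\mathbb{K}$ at $x_a,\dots,x_b$ and $0$ at every other vertex, with the identity on each arrow between two copies of $\mathbb{K}$ and zero maps elsewhere. For $0\le i\le \ell$ let $\chi(i)=\#\{j\le i\mid\tau_j=1\}$ and $\eta(i)=\#\{j\le i\mid\tau_j=0\}$, and write the level sets of these monotone functions as $\{i\mid\chi(i)=k\}=[a_k,b_k]$ for $0\le k\le\chi(\ell)$ and $\{i\mid\eta(i)=k\}=[a'_k,b'_k]$ for $0\le k\le\eta(\ell)$. Theorem. The set of complete central charges for $Q$ is nonempty, and a central charge $\alpha$ is complete for $Q$ if and only if both chains of inequalities $$\mu_\alpha(\mathbf{I}_\tau[a_0,b_0])>\mu_\alpha(\mathbf{I}_\tau[a_1,b_1])>\cdots>\mu_\alpha(\mathbf{I}_\tau[a_{\chi(\ell)},b_{\chi(\ell)}]),$$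 $$\mu_\alpha(\mathbf{I}_\tau[a'_0,b'_0])<\mu_\alpha(\mathbf{I}_\tau[a'_1,b'_1])<\cdots<\mu_\alpha(\mathbf{I}_\tau[a'_{\eta(\ell)},b'_{\eta(\ell)}])$$ hold. In particular, if $Q$ is equioriented (all $\tau_i=1$), then $\alpha$ is complete for $Q$ if and only if $\alpha(x_i)>\alpha(x_{i+1})$ for all $0\le i<\ell$. -/

import Mathlib

universe u v w

noncomputable section

/-- A finite-dimensional `K`-linear representation of a quiver `Q`. -/
structure QuiverRep (K : Type u) [Field K] (Q : Type v) [Quiver.{w} Q] where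
  /-- the vector space at a vertex -/
  obj : Q → Type u
  [addCommGroup : ∀ x, AddCommGroup (obj x)]
  [module : ∀ x, Module K (obj x)]
  [finiteDimensional : ∀ x, FiniteDimensional K (obj x)]
  /-- the linear map of an arrow -/
  map : ∀ {x y : Q}, (x ⟶ y) → (obj x →ₗ[K] obj y)

attribute [instance] QuiverRep.addCommGroup QuiverRep.module QuiverRep.finiteDimensional

namespace QuiverRep

variable {K : Type u} [Field K] {Q : Type v} [Quiver.{w} Q]

/-- Two representations are isomorphic: there is a family of linear isomorphisms, one for each
vertex, which commutes with the maps of all arrows. -/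
def Isomorphic (V W : QuiverRep K Q) : Prop :=
  ∃ φ : ∀ x, V.obj x ≃ₗ[K] W.obj x,
    ∀ (x y : Q) (e : x ⟶ y) (v : V.obj x), φ y (V.map e v) = W.map e (φ x v)

/-- The dimension vector. -/
def dimVec (V : QuiverRep K Q) : Q → ℕ := fun x => Module.finrank K (V.obj x)

/-- A representation is nonzero if one of its vector spaces is. -/
def IsNonzero (V : QuiverRep K Q) : Prop := ∃ x, Nontrivial (V.obj x)

/-- The slope of a (nonzero) representation along the central charge `α`. -/
def slope [Fintype Q] (α : Q → ℝ) (V : QuiverRep K Q) : ℝ :=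
  (∑ x, α x * (V.dimVec x : ℝ)) / (∑ x, (V.dimVec x : ℝ))

/-- A subrepresentation: a family of subspaces which is preserved by the maps of all arrows. -/
@[ext]
structure Subrep (V : QuiverRep K Q) where
  /-- the subspace at a vertex -/
  carrier : ∀ x, Submodule K (V.obj x)
  map_mem : ∀ {x y : Q} (e : x ⟶ y) (v : V.obj x), v ∈ carrier x → V.map e v ∈ carrier y

namespace Subrep

variable {V : QuiverRep K Q}

/-- Inclusion of subrepresentations is inclusion at every vertex. -/
instance : PartialOrder (Subrep V) :=
  PartialOrder.lift Subrep.carrier (fun _ _ h => Subrep.ext h)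

/-- The zero subrepresentation. -/
instance : Bot (Subrep V) where
  bot :=
    { carrier := fun _ => ⊥
      map_mem := fun e v hv => by
        rw [Submodule.mem_bot] at hv ⊢
        rw [hv, map_zero] }

/-- The whole representation. -/
instance : Top (Subrep V) where
  top :=
    { carrier := fun _ => ⊤
      map_mem := fun _ _ _ => Submodule.mem_top }

/-- A subrepresentation, regarded as a representation. -/
def toRep (U : Subrep V) : QuiverRep K Q where
  obj x := U.carrier x
  map {x y} e := (V.map e).restrict (p := U.carrier x) (q := U.carrier y) (U.map_mem e)

/-- The quotient representation `V / U`. -/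
def quotient (U : Subrep V) : QuiverRep K Q where
  obj x := V.obj x ⧸ U.carrier x
  map {x y} e := (U.carrier x).mapQ (U.carrier y) (V.map e) (U.map_mem e)

/-- The intersection of `U` with `W`, regarded as a subrepresentation of `W`. For `U ≤ W` this is
`U` itself, inside `W`. -/
def restrict (U W : Subrep V) : Subrep W.toRep where
  carrier x := (U.carrier x).comap (W.carrier x).subtype
  map_mem e v hv := U.map_mem e v.1 hv

/-- The subquotient `W / U`, for `U ≤ W`. -/
def subquotient (U W : Subrep V) : QuiverRep K Q := (U.restrict W).quotient

end Subrep

variable [Fintype Q]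

/-- `V` is `α`-semistable: it is nonzero, and no nonzero subrepresentation has a larger slope. -/
def IsSemistable (α : Q → ℝ) (V : QuiverRep K Q) : Prop :=
  V.IsNonzero ∧ ∀ U : Subrep V, U ≠ ⊥ → slope α U.toRep ≤ slope α V

/-- `0 = F 0 ⊊ F 1 ⊊ ⋯ ⊊ F n = V` is a Harder-Narasimhan filtration of `V` along `α`: the
successive quotients are semistable and have strictly decreasing slopes. (The zero representation
has exactly one such filtration, of length `0`.) -/
structure IsHNFiltration (α : Q → ℝ) (V : QuiverRep K Q) {n : ℕ} (F : Fin (n + 1) → Subrep V) :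
    Prop where
  bot : F 0 = ⊥
  top : F (Fin.last n) = ⊤
  strictMono : StrictMono F
  semistable : ∀ i : Fin n, IsSemistable α ((F i.castSucc).subquotient (F i.succ))
  slope_strictAnti : StrictAnti fun i : Fin n => slope α ((F i.castSucc).subquotient (F i.succ))

/-- `T` is the Harder-Narasimhan type of `V` along `α`: the list of the dimension vectors of the
successive quotients of the Harder-Narasimhan filtration of `V`. -/
def IsHNType (α : Q → ℝ) (V : QuiverRep K Q) (T : List (Q → ℕ)) : Prop :=
  ∃ (n : ℕ) (F : Fin (n + 1) → Subrep V), IsHNFiltration α V F ∧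
    T = List.ofFn fun i : Fin n => dimVec ((F i.castSucc).subquotient (F i.succ))

end QuiverRep

/-- The central charge `α` is complete for `Q` (over the field `K`): any two finite-dimensional
representations with the same Harder-Narasimhan type along `α` are isomorphic. -/
def IsCompleteCharge (K : Type u) [Field K] {Q : Type v} [Quiver.{w} Q] [Fintype Q]
    (α : Q → ℝ) : Prop :=
  ∀ V W : QuiverRep K Q,
    (∃ T : List (Q → ℕ), V.IsHNType α T ∧ W.IsHNType α T) → V.Isomorphic W

/-- The vertices `x_0, …, x_ℓ` of the type `A_ℓ` quiver of orientation `τ`. The edge between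
`x_i` and `x_{i+1}` has the orientation `τ i`, for `i : Fin ℓ`. -/
def TypeA {ℓ : ℕ} (_τ : Fin ℓ → Bool) : Type := Fin (ℓ + 1)

namespace TypeA

/-- The arrows of the type `A_ℓ` quiver: for each `i : Fin ℓ` there is one arrow, which is
`x_i ⟶ x_{i+1}` if `τ i = true` and `x_{i+1} ⟶ x_i` if `τ i = false`. -/
inductive Arrow {ℓ : ℕ} (τ : Fin ℓ → Bool) : Fin (ℓ + 1) → Fin (ℓ + 1) → Type
  | forward (i : Fin ℓ) (h : τ i = true) : Arrow τ i.castSucc i.succ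
  | backward (i : Fin ℓ) (h : τ i = false) : Arrow τ i.succ i.castSucc

variable {ℓ : ℕ} {τ : Fin ℓ → Bool}

instance : Quiver (TypeA τ) := ⟨Arrow τ⟩

instance : Fintype (TypeA τ) := inferInstanceAs (Fintype (Fin (ℓ + 1)))

instance : LinearOrder (TypeA τ) := inferInstanceAs (LinearOrder (Fin (ℓ + 1)))

instance : BoundedOrder (TypeA τ) := inferInstanceAs (BoundedOrder (Fin (ℓ + 1)))

/-- The vertex `x_i`. -/
def vertex (τ : Fin ℓ → Bool) (i : Fin (ℓ + 1)) : TypeA τ := i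

/-- The interval module of `[a, b]`: at a vertex of `[a, b]` the vector space is `K` (functions
from a one-point type to `K`), at any other vertex it is zero (functions from an empty type).
The map of an arrow is the identity of `K` if both ends lie in `[a, b]`, and zero otherwise. -/
def intervalModule (K : Type u) [Field K] (τ : Fin ℓ → Bool) (a b : TypeA τ) :
    QuiverRep K (TypeA τ) where
  obj x := PLift (a ≤ x ∧ x ≤ b) → K
  map {x y} _ :=
    { toFun := fun f _ => if h : a ≤ x ∧ x ≤ b then f ⟨h⟩ else 0
      map_add' := fun f g => by
        funext _
        by_cases h : a ≤ x ∧ x ≤ b <;> simp [h]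
      map_smul' := fun c f => by
        funext _
        by_cases h : a ≤ x ∧ x ≤ b <;> simp [h] }

/-- `χ(x_i)` is the number of forward edges among the first `i` edges. -/
def chi (τ : Fin ℓ → Bool) (x : TypeA τ) : ℕ :=
  Fin.induction (motive := fun _ => ℕ) 0 (fun i c => if τ i = true then c + 1 else c) x

/-- `η(x_i)` is the number of backward edges among the first `i` edges. -/
def eta (τ : Fin ℓ → Bool) (x : TypeA τ) : ℕ :=
  Fin.induction (motive := fun _ => ℕ) 0 (fun i c => if τ i = false then c + 1 else c) x

/-- The first vertex of the level set `{x | f x = k}`, if that is nonempty. -/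
def levelMin (f : TypeA τ → ℕ) (k : ℕ) : TypeA τ := (Finset.univ.filter fun x => f x = k).inf id

/-- The last vertex of the level set `{x | f x = k}`, if that is nonempty. -/
def levelMax (f : TypeA τ → ℕ) (k : ℕ) : TypeA τ := (Finset.univ.filter fun x => f x = k).sup id

/-- The interval module of the interval `[levelMin f k, levelMax f k]`; for monotone `f` that
interval is the level set `{x | f x = k}`. -/
def levelModule (K : Type u) [Field K] (f : TypeA τ → ℕ) (k : ℕ) : QuiverRep K (TypeA τ) :=
  intervalModule K τ (levelMin f k) (levelMax f k)

end TypeA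

end

/-
Let `S` be the sequence of partial sums of `α`. The slope of an interval module is the slope of a
chord of the graph of `S`, and all interval modules are `α`-stable ("total stability") if and only
if the graph passes above each chord at the inner cuts along forward arrows and below it at those
along backward arrows.

If total stability fails at a cut of a shortest interval, then the interval module and the direct
sum of its two parts have the same Harder-Narasimhan type, so `α` is not complete. Conversely,
decompose a representation into interval modules. Truncating the Harder-Narasimhan filtration at
an upper set `U` of slopes leaves exactly the summands with slope in `U`, so the type determines,
for every slope and vertex, the number of summands of that slope that contain the vertex. By total
stability two summands of equal slope neither share one end only nor abut, so the multiplicity of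
`[a, b)` is the jump of that number at `a`.

The two chains of slopes over level sets say that the polygon through the points of the graph after
the forward arrows is concave and the one through the points after the backward arrows is convex.
The graph then lies between the two polygons, which gives total stability. Partial sums on a
parabola at the forward cuts and on its mirror image at the backward cuts satisfy it.
-/

noncomputable section

/-! ### Subrepresentations and Harder-Narasimhan filtrations -/

namespace QuiverRep

variable {K : Type u} [Field K] {Q : Type v} [Quiver.{w} Q] {V : QuiverRep K Q}

theorem isNonzero_iff : V.IsNonzero ↔ V.dimVec ≠ 0 := by
  rw [Function.ne_iff]
  exact exists_congr fun x =>
    (Module.finrank_pos_iff (R := K) (M := V.obj x)).symm.trans Nat.pos_iff_ne_zero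

namespace Subrep

variable {A B C D M : Subrep V}

/-- The lattice operations are the intersection and the sum at every vertex. -/
instance : Lattice (Subrep V) where
  inf A B :=
    { carrier := fun x => A.carrier x ⊓ B.carrier x
      map_mem := fun e v hv => ⟨A.map_mem e v hv.1, B.map_mem e v hv.2⟩ }
  sup A B :=
    { carrier := fun x => A.carrier x ⊔ B.carrier x
      map_mem := fun e v hv => by
        obtain ⟨a, ha, b, hb, rfl⟩ := Submodule.mem_sup.1 hv
        rw [map_add]
        exact Submodule.add_mem_sup (A.map_mem e a ha) (B.map_mem e b hb) }
  inf_le_left _ _ _ := inf_le_left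
  inf_le_right _ _ _ := inf_le_right
  le_inf _ _ _ hAB hAC x := le_inf (hAB x) (hAC x)
  le_sup_left _ _ _ := le_sup_left
  le_sup_right _ _ _ := le_sup_right
  sup_le _ _ _ hAC hBC x := sup_le (hAC x) (hBC x)

instance : BoundedOrder (Subrep V) where
  le_top _ _ := le_top
  bot_le _ _ := bot_le

/-- The dimension vector of a subrepresentation. -/
def dimVec (A : Subrep V) : Q → ℕ := A.toRep.dimVec

theorem dimVec_bot : (⊥ : Subrep V).dimVec = 0 := funext fun x => finrank_bot K (V.obj x)

theorem dimVec_top : (⊤ : Subrep V).dimVec = V.dimVec := funext fun x => finrank_top K (V.obj x)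

theorem dimVec_mono (h : A ≤ B) : A.dimVec ≤ B.dimVec := fun x => Submodule.finrank_mono (h x)

theorem eq_of_le_of_dimVec_eq (h : A ≤ B) (hr : A.dimVec = B.dimVec) : A = B :=
  Subrep.ext (funext fun x => Submodule.eq_of_le_of_finrank_eq (h x) (congrFun hr x))

theorem dimVec_inf_add_dimVec_sup (A B : Subrep V) :
    (A ⊓ B).dimVec + (A ⊔ B).dimVec = A.dimVec + B.dimVec :=
  funext fun x => (add_comm _ _).trans
    (Submodule.finrank_sup_add_finrank_inf_eq (A.carrier x) (B.carrier x))

theorem isNonzero_toRep (h : A ≠ ⊥) : A.toRep.IsNonzero :=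
  isNonzero_iff.2 fun h0 =>
    h (eq_of_le_of_dimVec_eq bot_le (dimVec_bot.trans h0.symm)).symm

theorem dimVec_restrict (h : A ≤ B) : (A.restrict B).dimVec = A.dimVec :=
  funext fun x => (Submodule.comapSubtypeEquivOfLe (h x)).finrank_eq

theorem dimVec_subquotient_add_dimVec (h : A ≤ B) :
    (A.subquotient B).dimVec + A.dimVec = B.dimVec := by
  rw [← dimVec_restrict h]
  exact funext fun x => Submodule.finrank_quotient_add_finrank ((A.restrict B).carrier x)

theorem isNonzero_subquotient (h : A < B) : (A.subquotient B).IsNonzero :=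
  isNonzero_iff.2 fun h0 =>
    h.ne (eq_of_le_of_dimVec_eq h.le (by rw [← dimVec_subquotient_add_dimVec h.le, h0, zero_add]))

/-- The image of `M ⊓ B` in `B / A`. -/
def toSubquotient (A B M : Subrep V) : Subrep (A.subquotient B) where
  carrier x := ((M.restrict B).carrier x).map ((A.restrict B).carrier x).mkQ
  map_mem e v hv := by
    obtain ⟨m, hm, rfl⟩ := hv
    exact ⟨⟨V.map e m.1, B.map_mem e m.1 m.2⟩, M.map_mem e m.1 hm, rfl⟩

/-- The preimage in `B` of a subrepresentation of `B / A`. -/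
def ofSubquotient (A B : Subrep V) (N : Subrep (A.subquotient B)) : Subrep V where
  carrier x := ((N.carrier x).comap ((A.restrict B).carrier x).mkQ).map (B.carrier x).subtype
  map_mem e v hv := by
    obtain ⟨m, hm, rfl⟩ := hv
    exact ⟨⟨V.map e m.1, B.map_mem e m.1 m.2⟩, N.map_mem e _ hm, rfl⟩

theorem dimVec_toSubquotient_add_dimVec (hAM : A ≤ M) (hMB : M ≤ B) :
    (toSubquotient A B M).dimVec + A.dimVec = M.dimVec := by
  rw [← dimVec_restrict hMB, ← dimVec_restrict (hAM.trans hMB)]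
  funext x
  have hAM' : (A.restrict B).carrier x ≤ (M.restrict B).carrier x := Submodule.comap_mono (hAM x)
  have hrk := LinearMap.finrank_range_add_finrank_ker
    (((A.restrict B).carrier x).mkQ.domRestrict ((M.restrict B).carrier x))
  rwa [LinearMap.range_domRestrict, LinearMap.ker_domRestrict, Submodule.ker_mkQ,
    (Submodule.comapSubtypeEquivOfLe hAM').finrank_eq] at hrk

theorem le_ofSubquotient (h : A ≤ B) (N : Subrep (A.subquotient B)) :
    A ≤ ofSubquotient A B N := by
  intro x v hv
  have hzero : ((A.restrict B).carrier x).mkQ ⟨v, h x hv⟩ = 0 :=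
    (Submodule.Quotient.mk_eq_zero ((A.restrict B).carrier x)).2 hv
  refine ⟨⟨v, h x hv⟩, ?_, rfl⟩
  change ((A.restrict B).carrier x).mkQ ⟨v, h x hv⟩ ∈ N.carrier x
  exact hzero ▸ zero_mem (N.carrier x)

theorem ofSubquotient_le (A B : Subrep V) (N : Subrep (A.subquotient B)) :
    ofSubquotient A B N ≤ B := by
  rintro x _ ⟨m, -, rfl⟩
  exact m.2

theorem toSubquotient_ofSubquotient (A B : Subrep V) (N : Subrep (A.subquotient B)) :
    toSubquotient A B (ofSubquotient A B N) = N := by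
  ext x v
  constructor
  · rintro ⟨m, ⟨m', hm', h⟩, rfl⟩
    rwa [Submodule.subtype_injective _ h] at hm'
  · intro hv
    obtain ⟨m, rfl⟩ := Submodule.mkQ_surjective _ v
    exact ⟨m, ⟨m, hv, rfl⟩, rfl⟩

end Subrep

variable [Fintype Q]

section DimensionVectors

variable {Q : Type v} [Fintype Q] (α : Q → ℝ) (t : ℝ)

/-- The total value of `α - t` on a dimension vector, whose sign compares the slope with `t`. -/
def charge (d : Q → ℕ) : ℝ := ∑ x, (α x - t) * d x

/-- The slope, as a function of the dimension vector. -/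
def dimSlope (d : Q → ℕ) : ℝ := (∑ x, α x * (d x : ℝ)) / ∑ x, (d x : ℝ)

theorem charge_zero : charge α t 0 = 0 := by simp [charge]

theorem charge_add (d d' : Q → ℕ) : charge α t (d + d') = charge α t d + charge α t d' := by
  simp only [charge, Pi.add_apply, Nat.cast_add, mul_add, Finset.sum_add_distrib]

theorem charge_eq_sub_mul (d : Q → ℕ) :
    charge α t d = ∑ x, α x * (d x : ℝ) - t * ∑ x, (d x : ℝ) := by
  simp only [charge, sub_mul, Finset.sum_sub_distrib, Finset.mul_sum]

variable {d : Q → ℕ}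

theorem sum_cast_pos_of_ne_zero (h : d ≠ 0) : 0 < ∑ x, (d x : ℝ) := by
  obtain ⟨x, hx⟩ := Function.ne_iff.1 h
  exact Finset.sum_pos' (fun _ _ => Nat.cast_nonneg _)
    ⟨x, Finset.mem_univ x, Nat.cast_pos.2 (Nat.pos_of_ne_zero hx)⟩

theorem dimSlope_le_iff (h : d ≠ 0) : dimSlope α d ≤ t ↔ charge α t d ≤ 0 := by
  rw [dimSlope, div_le_iff₀ (sum_cast_pos_of_ne_zero h), charge_eq_sub_mul, sub_nonpos]

theorem dimSlope_eq_iff (h : d ≠ 0) : dimSlope α d = t ↔ charge α t d = 0 := by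
  rw [dimSlope, div_eq_iff (sum_cast_pos_of_ne_zero h).ne', charge_eq_sub_mul, sub_eq_zero]

theorem charge_strictAnti (h : d ≠ 0) : StrictAnti fun t => charge α t d := by
  intro s t hst
  have := mul_lt_mul_of_pos_right hst (sum_cast_pos_of_ne_zero h)
  simp only [charge_eq_sub_mul]
  linarith

end DimensionVectors

namespace Subrep

variable {A B C D M : Subrep V} {α : Q → ℝ} {p q t : ℝ}

/-- The subquotient `B / A` is semistable of slope `t` or zero; its subrepresentations correspond
to the `M` between `A` and `B`. -/
structure SemistableBetween (α : Q → ℝ) (t : ℝ) (A B : Subrep V) : Prop where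
  le : A ≤ B
  charge_eq : charge α t B.dimVec = charge α t A.dimVec
  charge_le : ∀ M, A ≤ M → M ≤ B → charge α t M.dimVec ≤ charge α t A.dimVec

theorem charge_inf_add_charge_sup (α : Q → ℝ) (t : ℝ) (A B : Subrep V) :
    charge α t (A ⊓ B).dimVec + charge α t (A ⊔ B).dimVec =
      charge α t A.dimVec + charge α t B.dimVec := by
  rw [← charge_add, dimVec_inf_add_dimVec_sup, charge_add]

theorem SemistableBetween.trans (hAB : SemistableBetween α t A B)
    (hBC : SemistableBetween α t B C) : SemistableBetween α t A C where
  le := hAB.le.trans hBC.le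
  charge_eq := hBC.charge_eq.trans hAB.charge_eq
  charge_le M hAM hMC := by
    have hinf := hAB.charge_le (M ⊓ B) (le_inf hAM hAB.le) inf_le_right
    have hsup := hBC.charge_le (M ⊔ B) le_sup_right (sup_le hMC hBC.le)
    linarith [charge_inf_add_charge_sup α t M B, hAB.charge_eq]

/-- There is no nonzero map from a semistable subquotient to one of smaller slope. -/
theorem SemistableBetween.le_of_lt (hAB : SemistableBetween α p A B)
    (hCD : SemistableBetween α q C D) (hqp : q < p) (hAC : A ≤ C) (hBD : B ≤ D) : B ≤ C := by
  have hinf := hAB.charge_le (B ⊓ C) (le_inf hAB.le hAC) inf_le_left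
  have hsup := hCD.charge_le (B ⊔ C) le_sup_right (sup_le hBD hCD.le)
  have hadd := dimVec_subquotient_add_dimVec (inf_le_left : B ⊓ C ≤ B)
  by_contra hBC
  have hne := isNonzero_iff.1 (isNonzero_subquotient (inf_lt_left.2 hBC))
  have hlt := charge_strictAnti α hne hqp
  have hp := charge_add α p ((B ⊓ C).subquotient B).dimVec (B ⊓ C).dimVec
  have hq := charge_add α q ((B ⊓ C).subquotient B).dimVec (B ⊓ C).dimVec
  rw [hadd] at hp hq
  have hmod := charge_inf_add_charge_sup α q B C
  linarith [hAB.charge_eq]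

theorem slope_subquotient_eq_iff (h : A < B) :
    slope α (A.subquotient B) = t ↔ charge α t B.dimVec = charge α t A.dimVec := by
  rw [← dimVec_subquotient_add_dimVec h.le, charge_add, add_eq_right]
  exact dimSlope_eq_iff α t (isNonzero_iff.1 (isNonzero_subquotient h))

theorem charge_le_of_isSemistable (hs : IsSemistable α (A.subquotient B))
    (hAM : A ≤ M) (hMB : M ≤ B) :
    charge α (slope α (A.subquotient B)) M.dimVec ≤
      charge α (slope α (A.subquotient B)) A.dimVec := by
  rw [← dimVec_toSubquotient_add_dimVec hAM hMB, charge_add, add_le_iff_nonpos_left]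
  by_cases hN : toSubquotient A B M = ⊥
  · rw [hN, dimVec_bot, charge_zero]
  · exact (dimSlope_le_iff α _ (isNonzero_iff.1 (isNonzero_toRep hN))).1
      (hs.2 _ hN)

theorem SemistableBetween.isSemistable_subquotient (h : A < B)
    (hs : SemistableBetween α t A B) : IsSemistable α (A.subquotient B) := by
  refine ⟨isNonzero_subquotient h, fun N hN => ?_⟩
  have hle := hs.charge_le _ (le_ofSubquotient h.le N) (ofSubquotient_le A B N)
  rw [← dimVec_toSubquotient_add_dimVec (le_ofSubquotient h.le N) (ofSubquotient_le A B N),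
    toSubquotient_ofSubquotient, charge_add, add_le_iff_nonpos_left] at hle
  rw [(slope_subquotient_eq_iff h).2 hs.charge_eq]
  exact (dimSlope_le_iff α t (isNonzero_iff.1 (isNonzero_toRep hN))).2 hle

theorem semistableBetween_slope (h : A < B) (hs : IsSemistable α (A.subquotient B)) :
    SemistableBetween α (slope α (A.subquotient B)) A B :=
  ⟨h.le, (slope_subquotient_eq_iff h).1 rfl, fun _ => charge_le_of_isSemistable hs⟩

end Subrep

open Subrep

variable {α : Q → ℝ} {p q : ℝ}

theorem isHNType_singleton (hV : (⊥ : Subrep V) < ⊤) (hs : SemistableBetween α p ⊥ (⊤ : Subrep V)) :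
    V.IsHNType α [V.dimVec] := by
  have hdim : ((⊥ : Subrep V).subquotient ⊤).dimVec = V.dimVec := by
    rw [← dimVec_top (V := V), ← dimVec_subquotient_add_dimVec hV.le, dimVec_bot, add_zero]
  refine ⟨1, ![⊥, ⊤], ⟨rfl, rfl, ?_, ?_, Subsingleton.strictAnti _⟩, ?_⟩
  · rw [Fin.strictMono_iff_lt_succ, Fin.forall_fin_one]
    exact hV
  · rw [Fin.forall_fin_one]
    exact hs.isSemistable_subquotient hV
  · rw [← hdim]
    rfl

theorem isHNType_pair {R : Subrep V} (h₁ : ⊥ < R) (h₂ : R < ⊤)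
    (hp : SemistableBetween α p ⊥ R) (hq : SemistableBetween α q R ⊤) (hqp : q < p) :
    V.IsHNType α [R.dimVec, V.dimVec - R.dimVec] := by
  have hdim₁ : ((⊥ : Subrep V).subquotient R).dimVec = R.dimVec := by
    rw [← dimVec_subquotient_add_dimVec h₁.le, dimVec_bot, add_zero]
  have hdim₂ : (R.subquotient ⊤).dimVec = V.dimVec - R.dimVec := by
    rw [← dimVec_top (V := V), ← dimVec_subquotient_add_dimVec h₂.le, add_tsub_cancel_right]
  refine ⟨2, ![⊥, R, ⊤], ⟨rfl, rfl, ?_, ?_, ?_⟩, ?_⟩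
  · rw [Fin.strictMono_iff_lt_succ, Fin.forall_fin_two]
    exact ⟨h₁, h₂⟩
  · rw [Fin.forall_fin_two]
    exact ⟨hp.isSemistable_subquotient h₁, hq.isSemistable_subquotient h₂⟩
  · rw [Fin.strictAnti_iff_succ_lt, Fin.forall_fin_one]
    exact ((slope_subquotient_eq_iff h₂).2 hq.charge_eq).trans_lt
      (hqp.trans_eq ((slope_subquotient_eq_iff h₁).2 hp.charge_eq).symm)
  · exact congrArg₂ (fun d d' => [d, d']) hdim₁.symm hdim₂.symm

theorem isHNType_of_semistableBetween {R : Subrep V} (h₁ : ⊥ < R) (h₂ : R < ⊤)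
    (hp : SemistableBetween α p ⊥ R) (hq : SemistableBetween α q R ⊤) (hqp : q ≤ p) :
    V.IsHNType α (if q < p then [R.dimVec, V.dimVec - R.dimVec] else [V.dimVec]) := by
  split_ifs with h
  · exact isHNType_pair h₁ h₂ hp hq h
  · obtain rfl : p = q := le_antisymm (not_lt.1 h) hqp
    exact isHNType_singleton (h₁.trans h₂) (hp.trans hq)

namespace IsHNFiltration

variable {n : ℕ} {F : Fin (n + 1) → Subrep V}

theorem lt_succ (hF : IsHNFiltration α V F) (i : Fin n) : F i.castSucc < F i.succ :=
  hF.strictMono i.castSucc_lt_succ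

theorem semistableBetween (hF : IsHNFiltration α V F) (i : Fin n) :
    SemistableBetween α (slope α ((F i.castSucc).subquotient (F i.succ)))
      (F i.castSucc) (F i.succ) :=
  semistableBetween_slope (hF.lt_succ i) (hF.semistable i)

theorem sum_dimVec (hF : IsHNFiltration α V F) (k : Fin (n + 1)) :
    ∑ i : Fin n with i.castSucc < k, ((F i.castSucc).subquotient (F i.succ)).dimVec =
      (F k).dimVec := by
  induction k using Fin.induction with
  | zero => simp only [Fin.not_lt_zero, Finset.filter_false, Finset.sum_empty, hF.bot, dimVec_bot]
  | succ k ih =>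
    have hins : Finset.filter (fun i : Fin n => i.castSucc < k.succ) Finset.univ =
        insert k (Finset.filter (fun i : Fin n => i.castSucc < k.castSucc) Finset.univ) := by
      ext i
      simp only [Fin.castSucc_lt_succ_iff, Finset.mem_filter_univ, Finset.mem_insert,
        Fin.castSucc_lt_castSucc_iff, le_iff_eq_or_lt]
    rw [hins, Finset.sum_insert (by simp), ih, dimVec_subquotient_add_dimVec (hF.lt_succ k).le]

theorem le_of_forall_lt_slope (hF : IsHNFiltration α V F) {C : Subrep V}
    (hC : SemistableBetween α q C ⊤) (k : Fin (n + 1))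
    (hk : ∀ i : Fin n, i.castSucc < k → q < slope α ((F i.castSucc).subquotient (F i.succ))) :
    F k ≤ C := by
  induction k using Fin.induction with
  | zero => exact hF.bot.trans_le bot_le
  | succ k ih =>
    exact (hF.semistableBetween k).le_of_lt hC (hk k k.castSucc_lt_succ)
      (ih fun i hi => hk i (hi.trans k.castSucc_lt_succ)) le_top

theorem le_of_forall_slope_lt (hF : IsHNFiltration α V F) {B : Subrep V}
    (hB : SemistableBetween α p ⊥ B) (k : Fin (n + 1))
    (hk : ∀ i : Fin n, k ≤ i.castSucc → slope α ((F i.castSucc).subquotient (F i.succ)) < p) :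
    B ≤ F k := by
  induction k using Fin.reverseInduction with
  | last => exact le_top.trans_eq hF.top.symm
  | cast k ih =>
    exact hB.le_of_lt (hF.semistableBetween k) (hk k le_rfl) bot_le
      (ih fun i hi => hk i (k.castSucc_lt_succ.le.trans hi))

theorem exists_slope_mem_iff_lt (hF : IsHNFiltration α V F) {U : Set ℝ} (hU : IsUpperSet U) :
    ∃ k : Fin (n + 1), ∀ i : Fin n,
      slope α ((F i.castSucc).subquotient (F i.succ)) ∈ U ↔ i.castSucc < k := by
  have hlow : IsLowerSet {i : Fin n | slope α ((F i.castSucc).subquotient (F i.succ)) ∈ U} :=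
    fun i j hji hi => hU (hF.slope_strictAnti.antitone hji) hi
  rcases hlow.eq_univ_or_Iio with h | ⟨k, h⟩
  · exact ⟨Fin.last n, fun i => iff_of_true (Set.eq_univ_iff_forall.1 h i) i.castSucc_lt_last⟩
  · exact ⟨k.castSucc, fun i => (Set.ext_iff.1 h i).trans Fin.castSucc_lt_castSucc_iff.symm⟩

end IsHNFiltration

open Classical in
/-- The term of the Harder-Narasimhan filtration above which the slopes leave `U`. -/
theorem IsHNType.exists_truncation {T : List (Q → ℕ)} (hT : V.IsHNType α T) {U : Set ℝ}
    (hU : IsUpperSet U) :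
    ∃ R : Subrep V, R.dimVec = (T.map fun d => if dimSlope α d ∈ U then d else 0).sum ∧
      (∀ q ∉ U, ∀ C, SemistableBetween α q C ⊤ → R ≤ C) ∧
      ∀ p ∈ U, ∀ B, SemistableBetween α p ⊥ B → B ≤ R := by
  obtain ⟨n, F, hF, rfl⟩ := hT
  obtain ⟨k, hk⟩ := hF.exists_slope_mem_iff_lt hU
  refine ⟨F k, ?_, fun q hq C hC => hF.le_of_forall_lt_slope hC k fun i hi => ?_,
    fun p hp B hB => hF.le_of_forall_slope_lt hB k fun i hi => ?_⟩
  · rw [← hF.sum_dimVec k, List.map_ofFn, List.sum_ofFn, Finset.sum_filter]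
    exact Finset.sum_congr rfl fun i _ => if_congr (hk i).symm rfl rfl
  · exact lt_of_not_ge fun hle => hq (hU hle ((hk i).2 hi))
  · exact lt_of_not_ge fun hle => hi.not_gt ((hk i).1 (hU hle hp))

end QuiverRep

/-! ### Polygonal graphs over `ℕ` -/

section Polygons

variable {S T : ℕ → ℝ} {i j k : ℕ}

/-- The slope of the chord from `a` to `b` of the graph of `S`. For partial sums of a central
charge this is the slope of the interval module of the vertices `a, …, b - 1`. -/
def chordSlope (S : ℕ → ℝ) (a b : ℕ) : ℝ := (S b - S a) / (b - a)

/-- Twice the signed area of the triangle with vertices `i`, `j`, `k` on the graph of `S`: it is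
positive if `j` lies above the chord from `i` to `k`. -/
def bulge (S : ℕ → ℝ) (i j k : ℕ) : ℝ := (S j - S i) * (k - j) - (S k - S j) * (j - i)

theorem chordSlope_neg (S : ℕ → ℝ) (a b : ℕ) : chordSlope (-S) a b = -chordSlope S a b := by
  simp only [chordSlope, Pi.neg_apply]
  ring

theorem bulge_neg (S : ℕ → ℝ) (i j k : ℕ) : bulge (-S) i j k = -bulge S i j k := by
  simp only [bulge, Pi.neg_apply]
  ring

theorem bulge_pos_iff (hij : i < j) (hjk : j < k) :
    0 < bulge S i j k ↔ chordSlope S j k < chordSlope S i j := by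
  rw [chordSlope, chordSlope, div_lt_div_iff₀ (sub_pos.2 (Nat.cast_lt.2 hjk))
    (sub_pos.2 (Nat.cast_lt.2 hij)), bulge, sub_pos]

theorem bulge_eq_zero_iff (hij : i < j) (hjk : j < k) :
    bulge S i j k = 0 ↔ chordSlope S i j = chordSlope S j k := by
  rw [chordSlope, chordSlope, div_eq_div_iff (sub_pos.2 (Nat.cast_lt.2 hij)).ne'
    (sub_pos.2 (Nat.cast_lt.2 hjk)).ne', bulge, sub_eq_zero]

theorem bulge_eq_zero_iff_chordSlope_left_eq (hij : i < j) (hjk : j < k) :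
    bulge S i j k = 0 ↔ chordSlope S i j = chordSlope S i k := by
  rw [chordSlope, chordSlope, div_eq_div_iff (sub_pos.2 (Nat.cast_lt.2 hij)).ne'
    (sub_pos.2 (Nat.cast_lt.2 (hij.trans hjk))).ne', bulge]
  constructor <;> intro h <;> linarith

theorem bulge_le_bulge (hij : i ≤ j) (hjk : j ≤ k) (hi : S i ≤ T i) (hj : T j ≤ S j)
    (hk : S k ≤ T k) : bulge T i j k ≤ bulge S i j k := by
  have hij' : (0 : ℝ) ≤ j - i := sub_nonneg.2 (Nat.cast_le.2 hij)
  have hjk' : (0 : ℝ) ≤ k - j := sub_nonneg.2 (Nat.cast_le.2 hjk)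
  exact sub_le_sub (mul_le_mul_of_nonneg_right (by linarith) hjk')
    (mul_le_mul_of_nonneg_right (by linarith) hij')

theorem bulge_eq_mul (S : ℕ → ℝ) (hik : i < k) (j : ℕ) :
    bulge S i j k = (S j - S i - chordSlope S i k * (j - i)) * (k - i) := by
  have hki : (k : ℝ) - i ≠ 0 := (sub_pos.2 (Nat.cast_lt.2 hik)).ne'
  rw [bulge, chordSlope]
  field_simp
  ring

/-- Abel summation: if `x` increases where `S` lies above its chord from `a` to `b` and decreases
where it lies below, then the increments of `S` and `x` are negatively correlated. -/
theorem sum_sub_chordSlope_mul_nonpos {a b : ℕ} (hab : a < b) {x : ℕ → ℝ}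
    (h : ∀ c, a ≤ c → c + 1 < b → 0 ≤ bulge S a (c + 1) b * (x (c + 1) - x c)) :
    ∑ j ∈ Finset.Ico a b, (S (j + 1) - S j - chordSlope S a b) * x j ≤ 0 := by
  have hba : (0 : ℝ) < b - a := sub_pos.2 (Nat.cast_lt.2 hab)
  set g : ℕ → ℝ := fun j => S j - S a - chordSlope S a b * (j - a) with hg
  have hga : g a = 0 := by simp [hg]
  have hgb : g b = 0 := by simp only [hg, chordSlope]; field_simp; ring
  have hterm : ∀ j, (S (j + 1) - S j - chordSlope S a b) * x j =
      (g (j + 1) * x (j + 1) - g j * x j) - g (j + 1) * (x (j + 1) - x j) := by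
    intro j
    simp only [hg, Nat.cast_add, Nat.cast_one]
    ring
  simp only [hterm]
  rw [Finset.sum_sub_distrib, Finset.sum_Ico_sub (fun j => g j * x j) hab.le, hga, hgb, zero_mul,
    zero_mul, sub_zero, zero_sub, neg_nonpos]
  refine Finset.sum_nonneg fun c hc => ?_
  obtain ⟨hac, hcb⟩ := Finset.mem_Ico.1 hc
  rcases (Nat.succ_le_of_lt hcb).eq_or_lt with heq | hlt
  · rw [show c + 1 = b from heq, hgb, zero_mul]
  · have hnn := h c hac hlt
    rw [bulge_eq_mul S hab, mul_right_comm] at hnn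
    exact nonneg_of_mul_nonneg_left hnn hba

theorem bulge_eq_sum (hij : i ≤ j) (hjk : j ≤ k) :
    bulge S i j k = ∑ u ∈ Finset.Ico i j, ∑ v ∈ Finset.Ico j k,
      ((S (u + 1) - S u) - (S (v + 1) - S v)) := by
  rw [bulge, ← Finset.sum_Ico_sub S hij, ← Finset.sum_Ico_sub S hjk, ← Nat.cast_sub hij,
    ← Nat.cast_sub hjk]
  obtain ⟨s, hs⟩ : ∃ s : ℕ → ℝ, ∀ u, S (u + 1) - S u = s u := ⟨_, fun _ => rfl⟩
  simp only [hs, Finset.sum_sub_distrib, Finset.sum_const, Nat.card_Ico, nsmul_eq_mul,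
    ← Finset.mul_sum]
  ring

theorem bulge_nonneg (hij : i ≤ j) (hjk : j ≤ k)
    (h : ∀ u v, i ≤ u → u < j → j ≤ v → v < k → S (v + 1) - S v ≤ S (u + 1) - S u) :
    0 ≤ bulge S i j k := by
  rw [bulge_eq_sum hij hjk]
  refine Finset.sum_nonneg fun u hu => Finset.sum_nonneg fun v hv => sub_nonneg.2 ?_
  exact h u v (Finset.mem_Ico.1 hu).1 (Finset.mem_Ico.1 hu).2
    (Finset.mem_Ico.1 hv).1 (Finset.mem_Ico.1 hv).2

theorem bulge_pos (hij : i < j) (hjk : j < k)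
    (h : ∀ u v, i ≤ u → u < j → j ≤ v → v < k → S (v + 1) - S v < S (u + 1) - S u) :
    0 < bulge S i j k := by
  rw [bulge_eq_sum hij.le hjk.le]
  refine Finset.sum_pos (fun u hu => Finset.sum_pos (fun v hv => sub_pos.2 ?_)
    (Finset.nonempty_Ico.2 hjk)) (Finset.nonempty_Ico.2 hij)
  exact h u v (Finset.mem_Ico.1 hu).1 (Finset.mem_Ico.1 hu).2
    (Finset.mem_Ico.1 hv).1 (Finset.mem_Ico.1 hv).2

/-- For every edge `c` with `p c`, the point `c + 1` of the graph of `S` on `0, …, ℓ + 1` lies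
strictly above all chords that pass over it. -/
def AboveChords (p : ℕ → Prop) (S : ℕ → ℝ) (ℓ : ℕ) : Prop :=
  ∀ a c b, a ≤ c → c + 1 < b → b ≤ ℓ + 1 → p c → 0 < bulge S a (c + 1) b

theorem aboveChords_of_le_parabola {p : ℕ → Prop} {ℓ : ℕ}
    (hS : ∀ i ≤ ℓ + 1, S i ≤ i * ((ℓ + 1 : ℕ) - i))
    (hp : ∀ c, p c → S (c + 1) = (c + 1 : ℕ) * ((ℓ + 1 : ℕ) - (c + 1 : ℕ))) :
    AboveChords p S ℓ := by
  intro a c b hac hcb hb hc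
  refine lt_of_lt_of_le ?_ (bulge_le_bulge (T := fun i : ℕ => i * ((ℓ + 1 : ℕ) - i)) (by omega)
    hcb.le (hS a (by omega)) (hp c hc).ge (hS b hb))
  have hac' : (0 : ℝ) < (c + 1 : ℕ) - a := sub_pos.2 (Nat.cast_lt.2 (by omega))
  have hcb' : (0 : ℝ) < b - (c + 1 : ℕ) := sub_pos.2 (Nat.cast_lt.2 hcb)
  have hpos := mul_pos (mul_pos hac' hcb') (add_pos hac' hcb')
  rw [bulge]
  linarith

end Polygons

theorem lt_count_iff_of_isLowerSet {P : ℕ → Prop} [DecidablePred P]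
    (hP : ∀ ⦃i j⦄, i ≤ j → P j → P i) {j n : ℕ} : j < Nat.count P n ↔ j < n ∧ P j := by
  refine ⟨fun h => ⟨h.trans_le (Nat.count_le P), ?_⟩, fun ⟨hjn, hj⟩ => ?_⟩
  · by_contra hj
    have hzero : Nat.count (fun i => P (j + i)) (n - j) = 0 :=
      Nat.count_iff_forall_not.2 fun i _ hi => hj (hP (Nat.le_add_right j i) hi)
    have hadd := Nat.count_add P j (n - j)
    rw [Nat.add_sub_cancel' (h.le.trans (Nat.count_le P)), hzero, add_zero] at hadd
    exact absurd (Nat.count_le P (n := j)) (by omega)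
  · have hall : Nat.count P (j + 1) = j + 1 :=
      Nat.count_iff_forall.2 fun i hi => hP (Nat.lt_succ_iff.1 hi) hj
    exact hall.ge.trans (Nat.count_monotone P hjn)

section Levels

variable (p q : ℕ → Prop) [DecidablePred p] [DecidablePred q] (S : ℕ → ℝ) (ℓ : ℕ)

/-- The first `j` at which the number of the edges before `j` that satisfy `p` is `k`. On the
vertices `0, …, ℓ` the level set of `Nat.count p` at `k` is thus the interval
`[levelStart p ℓ k, levelStart p ℓ (k + 1))`, and `levelStart p ℓ k = ℓ + 1` if `k` is not
attained. -/
def levelStart (k : ℕ) : ℕ := Nat.count (fun j => Nat.count p j < k) (ℓ + 1)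

/-- The slope of `S` over the level set of `Nat.count p` at `k`. -/
def levelSlope (k : ℕ) : ℝ := chordSlope S (levelStart p ℓ k) (levelStart p ℓ (k + 1))

/-- The slopes of `S` over the level sets of `Nat.count p` decrease strictly. -/
def LevelChain : Prop := ∀ k < Nat.count p ℓ, levelSlope p S ℓ (k + 1) < levelSlope p S ℓ k

variable {p q S ℓ}

theorem lt_levelStart_iff {j k : ℕ} :
    j < levelStart p ℓ k ↔ j ≤ ℓ ∧ Nat.count p j < k :=
  (lt_count_iff_of_isLowerSet fun _ _ hij h => (Nat.count_monotone p hij).trans_lt h).trans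
    (and_congr_left' Nat.lt_succ_iff)

theorem levelStart_zero : levelStart p ℓ 0 = 0 := by
  simp only [levelStart, Nat.not_lt_zero, Nat.count_false]

theorem levelStart_le (k : ℕ) : levelStart p ℓ k ≤ ℓ + 1 := Nat.count_le _

theorem levelStart_lt_levelStart_succ {k : ℕ} (hk : k ≤ Nat.count p ℓ) :
    levelStart p ℓ k < levelStart p ℓ (k + 1) := by
  have hle : levelStart p ℓ k ≤ ℓ :=
    not_lt.1 fun hlt => hk.not_gt (lt_levelStart_iff.1 hlt).2
  refine lt_levelStart_iff.2 ⟨hle, ?_⟩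
  rcases hm : levelStart p ℓ k with - | m
  · exact (Nat.count_zero p).trans_lt k.succ_pos
  · have hmk : Nat.count p m < k := (lt_levelStart_iff.1 (m.lt_succ_self.trans_eq hm.symm)).2
    rw [Nat.count_succ]
    split_ifs <;> omega

theorem levelStart_eq_of_count_lt {k : ℕ} (h : Nat.count p ℓ < k) : levelStart p ℓ k = ℓ + 1 :=
  (levelStart_le k).antisymm (lt_levelStart_iff.2 ⟨le_rfl, h⟩)

theorem levelStart_count_succ {c : ℕ} (hc : p c) (hcℓ : c < ℓ) :
    levelStart p ℓ (Nat.count p c + 1) = c + 1 := by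
  refine eq_of_forall_lt_iff fun j => lt_levelStart_iff.trans ⟨fun ⟨_, h⟩ => ?_, fun h => ?_⟩
  · by_contra! hcj
    exact (Nat.count_strict_mono hc (Nat.lt_of_succ_le hcj)).not_ge (Nat.lt_succ_iff.1 h)
  · exact ⟨by omega, Nat.lt_succ_of_le (Nat.count_monotone p (Nat.lt_succ_iff.1 h))⟩

theorem LevelChain.levelSlope_lt (h : LevelChain p S ℓ) {j k : ℕ} (hjk : j < k)
    (hk : k ≤ Nat.count p ℓ) : levelSlope p S ℓ k < levelSlope p S ℓ j := by
  induction k, hjk using Nat.le_induction with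
  | base => exact h j hk
  | succ k _ ih => exact (h k hk).trans (ih (by omega))

theorem AboveChords.levelChain (h : AboveChords p S ℓ) : LevelChain p S ℓ := by
  intro k hk
  obtain ⟨c, hcℓ, hc, rfl⟩ : ∃ c < ℓ, p c ∧ Nat.count p c = k :=
    ⟨Nat.nth p k, Nat.nth_lt_of_lt_count hk, Nat.nth_mem k fun hp =>
      hk.trans_le (Nat.count_le_card hp ℓ), Nat.count_nth fun hp =>
      hk.trans_le (Nat.count_le_card hp ℓ)⟩
  have hsucc : Nat.count p (c + 1) = Nat.count p c + 1 := Nat.count_succ_eq_succ_count_iff.2 hc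
  have hleft : levelStart p ℓ (Nat.count p c) ≤ c :=
    not_lt.1 fun hlt => lt_irrefl _ (lt_levelStart_iff.1 hlt).2
  have hright : c + 1 < levelStart p ℓ (Nat.count p c + 1 + 1) :=
    lt_levelStart_iff.2 ⟨hcℓ, by omega⟩
  rw [levelSlope, levelSlope, levelStart_count_succ hc hcℓ,
    ← bulge_pos_iff (Nat.lt_succ_of_le hleft) hright]
  exact h _ c _ hleft hright (levelStart_le _) hc

variable (p S ℓ)

/-- The polygonal graph through the points of the graph of `S` at the ends of the level sets of
`Nat.count p`, moved to start at `0`. -/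
def levelHull (i : ℕ) : ℝ := ∑ j ∈ Finset.range i, levelSlope p S ℓ (Nat.count p j)

variable {p S ℓ}

theorem levelHull_succ_sub (i : ℕ) :
    levelHull p S ℓ (i + 1) - levelHull p S ℓ i = levelSlope p S ℓ (Nat.count p i) := by
  rw [levelHull, levelHull, Finset.sum_range_succ, add_sub_cancel_left]

theorem levelHull_neg (i : ℕ) : levelHull p (-S) ℓ i = -levelHull p S ℓ i := by
  simp only [levelHull, levelSlope, chordSlope_neg, Finset.sum_neg_distrib]

theorem levelHull_levelStart (k : ℕ) :
    levelHull p S ℓ (levelStart p ℓ k) = S (levelStart p ℓ k) - S 0 := by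
  induction k with
  | zero => simp [levelStart_zero, levelHull]
  | succ k ih =>
    have hle : levelStart p ℓ k ≤ levelStart p ℓ (k + 1) :=
      Nat.count_mono_left fun j _ h => Nat.lt_succ_of_lt h
    have hlevel : ∀ j ∈ Finset.Ico (levelStart p ℓ k) (levelStart p ℓ (k + 1)),
        levelSlope p S ℓ (Nat.count p j) = levelSlope p S ℓ k := by
      intro j hj
      obtain ⟨hkj, hjk⟩ := Finset.mem_Ico.1 hj
      obtain ⟨hjℓ, hjk⟩ := lt_levelStart_iff.1 hjk
      rw [← not_lt, lt_levelStart_iff] at hkj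
      congr 1
      omega
    have hstep : levelHull p S ℓ (levelStart p ℓ (k + 1)) - levelHull p S ℓ (levelStart p ℓ k) =
        S (levelStart p ℓ (k + 1)) - S (levelStart p ℓ k) := by
      rw [levelHull, levelHull, ← Finset.sum_Ico_eq_sub _ hle, Finset.sum_congr rfl hlevel,
        Finset.sum_const, Nat.card_Ico, nsmul_eq_mul, Nat.cast_sub hle, levelSlope, chordSlope]
      rcases hle.eq_or_lt with h | h
      · rw [h]
        simp
      · exact mul_div_cancel₀ _ (sub_pos.2 (Nat.cast_lt.2 h)).ne'
    linarith

theorem levelHull_succ_of_edge {c : ℕ} (hc : p c) (hcℓ : c < ℓ) :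
    levelHull p S ℓ (c + 1) = S (c + 1) - S 0 := by
  rw [← levelStart_count_succ hc hcℓ, levelHull_levelStart]

theorem levelHull_last : levelHull p S ℓ (ℓ + 1) = S (ℓ + 1) - S 0 := by
  rw [← levelStart_eq_of_count_lt (Nat.lt_succ_self (Nat.count p ℓ)), levelHull_levelStart]

theorem LevelChain.levelHull_le_levelHull (hp : LevelChain p S ℓ) (hq : LevelChain q (-S) ℓ)
    {i : ℕ} (hi : i ≤ ℓ + 1) : levelHull q S ℓ i ≤ levelHull p S ℓ i := by
  set D : ℕ → ℝ := fun i => levelHull p S ℓ i + levelHull q (-S) ℓ i with hD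
  have hD0 : D 0 = 0 := by simp [hD, levelHull]
  have hDlast : D (ℓ + 1) = 0 := by simp only [hD, levelHull_last, Pi.neg_apply]; ring
  have hanti : ∀ {r : ℕ → Prop} [DecidablePred r] {R : ℕ → ℝ}, LevelChain r R ℓ →
      ∀ u v, u ≤ v → v ≤ ℓ →
        levelSlope r R ℓ (Nat.count r v) ≤ levelSlope r R ℓ (Nat.count r u) := by
    intro r _ R hr u v huv hv
    rcases (Nat.count_monotone r huv).eq_or_lt with h | h
    · rw [h]
    · exact (hr.levelSlope_lt h (Nat.count_monotone r hv)).le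
  have hbulge : 0 ≤ bulge D 0 i (ℓ + 1) := by
    refine bulge_nonneg (Nat.zero_le i) hi fun u v _ hu hv hvℓ => ?_
    have h₁ := hanti hp u v (by omega) (by omega)
    have h₂ := hanti hq u v (by omega) (by omega)
    simp only [← levelHull_succ_sub] at h₁ h₂
    simp only [hD]
    linarith
  have harea : bulge D 0 i (ℓ + 1) = D i * (ℓ + 1 : ℕ) := by
    rw [bulge, hD0, hDlast]
    push_cast
    ring
  have hDi : 0 ≤ D i := nonneg_of_mul_nonneg_left (harea ▸ hbulge) (Nat.cast_pos.2 ℓ.succ_pos)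
  simp only [hD, levelHull_neg] at hDi
  linarith

/-- Both chains force the graph of `S` to lie between a concave polygonal graph through its
points after the `p`-edges and a convex one through its points after the `q`-edges. -/
theorem LevelChain.le_levelHull (hpq : ∀ c < ℓ, p c ∨ q c) (hp : LevelChain p S ℓ)
    (hq : LevelChain q (-S) ℓ) {i : ℕ} (hi : i ≤ ℓ + 1) : S i - S 0 ≤ levelHull p S ℓ i := by
  rcases hi.eq_or_lt with rfl | hi
  · exact levelHull_last.ge
  · cases i with
    | zero => simp [levelHull]
    | succ c =>
      have hcℓ : c < ℓ := by omega
      rcases hpq c hcℓ with hc | hc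
      · exact (levelHull_succ_of_edge hc hcℓ).ge
      · rw [← levelHull_succ_of_edge hc hcℓ]
        exact hp.levelHull_le_levelHull hq hi.le

theorem LevelChain.aboveChords (hpq : ∀ c < ℓ, p c ∨ q c) (hp : LevelChain p S ℓ)
    (hq : LevelChain q (-S) ℓ) : AboveChords p S ℓ := by
  intro a c b hac hcb hb hc
  have hhull : 0 < bulge (levelHull p S ℓ) a (c + 1) b := by
    refine bulge_pos (by omega) hcb fun u v _ hu hv hvb => ?_
    rw [levelHull_succ_sub, levelHull_succ_sub]
    exact hp.levelSlope_lt ((Nat.count_monotone p (Nat.lt_succ_iff.1 hu)).trans_lt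
      (Nat.count_strict_mono hc hv)) (Nat.count_monotone p (by omega))
  have hshift : bulge (fun i => S i - S 0) a (c + 1) b = bulge S a (c + 1) b := by
    simp only [bulge]
    ring
  rw [← hshift]
  exact hhull.trans_le (bulge_le_bulge (by omega) hcb.le (hp.le_levelHull hpq hq (by omega))
    (levelHull_succ_of_edge hc (by omega)).le (hp.le_levelHull hpq hq hb))

end Levels

/-! ### Intervals and stability in type `A` -/

/-- The dimension vector of the representations that are one-dimensional on `I` and zero off
`I`. -/
def thinVec {Q : Type v} (I : Set Q) : Q → ℕ := I.indicator 1

theorem thinVec_of_mem {Q : Type v} {I : Set Q} {x : Q} (h : x ∈ I) : thinVec I x = 1 :=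
  Set.indicator_of_mem h 1

theorem thinVec_of_notMem {Q : Type v} {I : Set Q} {x : Q} (h : x ∉ I) : thinVec I x = 0 :=
  Set.indicator_of_notMem h 1

theorem thinVec_inter_add_thinVec_diff {Q : Type v} (I Y : Set Q) :
    thinVec (I ∩ Y) + thinVec (I \ Y) = thinVec I := by
  have hunion := Set.indicator_union_of_disjoint (M := ℕ)
    (Set.disjoint_sdiff_inter (s := I) (t := Y)).symm 1
  rwa [Set.inter_union_sdiff, eq_comm] at hunion

theorem finrank_pLift_fun (K : Type u) [Field K] {Q : Type v} {I : Set Q} {x : Q} {P : Prop}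
    (h : P ↔ x ∈ I) : Module.finrank K (PLift P → K) = thinVec I x := by
  classical
  rw [Module.finrank_fintype_fun_eq_card]
  by_cases hP : P
  · rw [thinVec_of_mem (h.1 hP)]
    exact Fintype.card_eq_one_iff.2 ⟨⟨hP⟩, fun _ => rfl⟩
  · rw [thinVec_of_notMem (mt h.2 hP)]
    exact Fintype.card_eq_zero_iff.2 ⟨fun hP' => hP hP'.down⟩

namespace TypeA

open QuiverRep QuiverRep.Subrep

variable {ℓ : ℕ} {τ : Fin ℓ → Bool}

/-- The index `i` of the vertex `x_i`. -/
def idx (x : TypeA τ) : ℕ := Fin.val (n := ℓ + 1) x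

theorem idx_lt (x : TypeA τ) : idx x < ℓ + 1 := Fin.isLt (n := ℓ + 1) x

theorem idx_injective : Function.Injective (idx : TypeA τ → ℕ) := Fin.val_injective

/-- The vertex `x_i`, for `i ≤ ℓ`; indices beyond `ℓ` wrap around. -/
def vertexAt (τ : Fin ℓ → Bool) (i : ℕ) : TypeA τ := Fin.ofNat (ℓ + 1) i

theorem idx_vertexAt {i : ℕ} (hi : i < ℓ + 1) : idx (vertexAt τ i) = i := Nat.mod_eq_of_lt hi

theorem vertexAt_idx (x : TypeA τ) : vertexAt τ (idx x) = x :=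
  idx_injective (idx_vertexAt (idx_lt x))

/-- The edge between `x_c` and `x_{c+1}` points to `x_{c+1}`. -/
def IsForward (τ : Fin ℓ → Bool) (c : ℕ) : Prop := ∃ h : c < ℓ, τ ⟨c, h⟩ = true

/-- The edge between `x_c` and `x_{c+1}` points to `x_c`. -/
def IsBackward (τ : Fin ℓ → Bool) (c : ℕ) : Prop := ∃ h : c < ℓ, τ ⟨c, h⟩ = false

instance : DecidablePred (IsForward τ) := fun _ => inferInstanceAs (Decidable (∃ _, _))

instance : DecidablePred (IsBackward τ) := fun _ => inferInstanceAs (Decidable (∃ _, _))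

theorem isForward_or_isBackward {c : ℕ} (hc : c < ℓ) : IsForward τ c ∨ IsBackward τ c :=
  (Bool.eq_false_or_eq_true (τ ⟨c, hc⟩)).imp (⟨hc, ·⟩) (⟨hc, ·⟩)

theorem IsForward.not_isBackward {c : ℕ} (hc : IsForward τ c) : ¬IsBackward τ c :=
  fun ⟨_, h⟩ => Bool.false_ne_true (h.symm.trans hc.2)

theorem arrow_cases {x y : TypeA τ} (e : x ⟶ y) :
    (idx y = idx x + 1 ∧ IsForward τ (idx x)) ∨ (idx x = idx y + 1 ∧ IsBackward τ (idx y)) :=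
  match e with
  | .forward i h => Or.inl ⟨rfl, i.2, h⟩
  | .backward i h => Or.inr ⟨rfl, i.2, h⟩

theorem IsForward.nonempty_hom {x y : TypeA τ} (h : IsForward τ (idx x))
    (hxy : idx y = idx x + 1) : Nonempty (x ⟶ y) := by
  obtain rfl : y = Fin.succ ⟨idx x, h.1⟩ := idx_injective hxy
  exact ⟨Arrow.forward ⟨idx x, h.1⟩ h.2⟩

theorem IsBackward.nonempty_hom {x y : TypeA τ} (h : IsBackward τ (idx x))
    (hxy : idx y = idx x + 1) : Nonempty (y ⟶ x) := by
  obtain rfl : y = Fin.succ ⟨idx x, h.1⟩ := idx_injective hxy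
  exact ⟨Arrow.backward ⟨idx x, h.1⟩ h.2⟩

/-- The interval of the vertices `x_a, …, x_{b-1}`. Intervals are half-open throughout, so that
adjacent ones share an end. -/
def interval (τ : Fin ℓ → Bool) (a b : ℕ) : Set (TypeA τ) := idx ⁻¹' Set.Ico a b

/-- The partial sums of a central charge. -/
def height (α : TypeA τ → ℝ) (i : ℕ) : ℝ := ∑ j ∈ Finset.range i, α (vertexAt τ j)

theorem height_succ_sub (α : TypeA τ → ℝ) (i : ℕ) :
    height α (i + 1) - height α i = α (vertexAt τ i) := by
  rw [height, height, Finset.sum_range_succ, add_sub_cancel_left]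

variable {a b : ℕ}

theorem sum_eq_sum_Ico {g : TypeA τ → ℝ} (hb : b ≤ ℓ + 1) (hg : ∀ x ∉ interval τ a b, g x = 0) :
    ∑ x, g x = ∑ j ∈ Finset.Ico a b, g (vertexAt τ j) := by
  have hrange : ∑ x, g x = ∑ j ∈ Finset.range (ℓ + 1), g (vertexAt τ j) := by
    rw [Finset.sum_range]
    exact Finset.sum_congr rfl fun x _ => congrArg g (vertexAt_idx x).symm
  rw [hrange]
  refine (Finset.sum_subset (fun j hj => ?_) fun j hj hj' => hg _ fun hmem => hj' ?_).symm
  · exact Finset.mem_range.2 ((Finset.mem_Ico.1 hj).2.trans_le hb)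
  · rwa [interval, Set.mem_preimage, idx_vertexAt (Finset.mem_range.1 hj), ← Finset.mem_coe,
      Finset.coe_Ico] at *

theorem vertexAt_mem_interval (hb : b ≤ ℓ + 1) {j : ℕ} (haj : a ≤ j) (hjb : j < b) :
    vertexAt τ j ∈ interval τ a b := by
  rw [interval, Set.mem_preimage, idx_vertexAt (hjb.trans_le hb)]
  exact ⟨haj, hjb⟩

theorem sum_mul_thinVec (g : TypeA τ → ℝ) (hb : b ≤ ℓ + 1) :
    ∑ x, g x * (thinVec (interval τ a b) x : ℝ) =
      ∑ j ∈ Finset.Ico a b, g (vertexAt τ j) := by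
  rw [sum_eq_sum_Ico hb fun x hx => by rw [thinVec_of_notMem hx, Nat.cast_zero, mul_zero]]
  refine Finset.sum_congr rfl fun j hj => ?_
  obtain ⟨haj, hjb⟩ := Finset.mem_Ico.1 hj
  rw [thinVec_of_mem (vertexAt_mem_interval hb haj hjb), Nat.cast_one, mul_one]

theorem thinVec_interval_ne_zero (hab : a < b) (hb : b ≤ ℓ + 1) :
    thinVec (interval τ a b) ≠ 0 :=
  Function.ne_iff.2
    ⟨_, (thinVec_of_mem (vertexAt_mem_interval hb le_rfl hab)).trans_ne one_ne_zero⟩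

theorem dimSlope_thinVec_interval (α : TypeA τ → ℝ) (hab : a ≤ b) (hb : b ≤ ℓ + 1) :
    dimSlope α (thinVec (interval τ a b)) = chordSlope (height α) a b := by
  have hnum := sum_mul_thinVec (a := a) α hb
  have hden := sum_mul_thinVec (τ := τ) (a := a) (fun _ => 1) hb
  simp only [one_mul, Finset.sum_const, Nat.card_Ico, nsmul_eq_mul, mul_one,
    Nat.cast_sub hab] at hden
  rw [dimSlope, hnum, hden, chordSlope, height, height, Finset.sum_Ico_eq_sub _ hab]

/-- The interval module of `[a, b)` is stable along `α`: at each inner cut `c + 1` the part which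
is a subrepresentation has the smaller slope. -/
def StableOn (α : TypeA τ → ℝ) (a b : ℕ) : Prop :=
  ∀ c, a ≤ c → c + 1 < b → (IsForward τ c → 0 < bulge (height α) a (c + 1) b) ∧
    (IsBackward τ c → bulge (height α) a (c + 1) b < 0)

theorem StableOn.charge_nonpos {α : TypeA τ → ℝ} (hα : StableOn α a b) (hab : a < b)
    (hb : b ≤ ℓ + 1) {d : TypeA τ → ℕ} (hd : ∀ x ∉ interval τ a b, d x = 0)
    (harr : ∀ x ∈ interval τ a b, ∀ y ∈ interval τ a b, (x ⟶ y) → d x ≤ d y) :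
    charge α (chordSlope (height α) a b) d ≤ 0 := by
  have habel := sum_sub_chordSlope_mul_nonpos (S := height α) hab
    (x := fun j => (d (vertexAt τ j) : ℝ)) fun c hac hcb => ?_
  · simp only [height_succ_sub] at habel
    rwa [charge, sum_eq_sum_Ico hb fun x hx => by rw [hd x hx, Nat.cast_zero, mul_zero]]
  have hidx : idx (vertexAt τ c) = c := idx_vertexAt (by omega)
  have hidx' : idx (vertexAt τ (c + 1)) = c + 1 := idx_vertexAt (by omega)
  have hmem : vertexAt τ c ∈ interval τ a b := vertexAt_mem_interval hb hac (by omega)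
  have hmem' : vertexAt τ (c + 1) ∈ interval τ a b := vertexAt_mem_interval hb (by omega) hcb
  rcases isForward_or_isBackward (τ := τ) (show c < ℓ by omega) with hc | hc
  · obtain ⟨e⟩ := IsForward.nonempty_hom (hidx.symm ▸ hc) (hidx'.trans (by rw [hidx]))
    exact mul_nonneg ((hα c hac hcb).1 hc).le
      (sub_nonneg.2 (Nat.cast_le.2 (harr _ hmem _ hmem' e)))
  · obtain ⟨e⟩ := IsBackward.nonempty_hom (hidx.symm ▸ hc) (hidx'.trans (by rw [hidx]))
    exact mul_nonneg_of_nonpos_of_nonpos ((hα c hac hcb).2 hc).le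
      (sub_nonpos.2 (Nat.cast_le.2 (harr _ hmem' _ hmem e)))

/-- A subquotient `B / A` which looks like a stable interval module is semistable. -/
theorem StableOn.semistableBetween {K : Type u} [Field K] {V : QuiverRep K (TypeA τ)}
    {α : TypeA τ → ℝ} (hα : StableOn α a b) (hab : a < b) (hb : b ≤ ℓ + 1) {A B : Subrep V}
    (hAB : A ≤ B) (hd : B.dimVec = thinVec (interval τ a b) + A.dimVec)
    (hinj : ∀ x ∈ interval τ a b, ∀ y ∈ interval τ a b, ∀ e : x ⟶ y, ∀ v ∈ B.carrier x,
      V.map e v ∈ A.carrier y → v ∈ A.carrier x) :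
    SemistableBetween α (chordSlope (height α) a b) A B := by
  refine ⟨hAB, ?_, fun M hAM hMB => ?_⟩
  · rw [hd, charge_add, add_eq_right, ← dimSlope_eq_iff α _ (thinVec_interval_ne_zero hab hb),
      dimSlope_thinVec_interval α hab.le hb]
  obtain ⟨d, hdM⟩ : ∃ d, M.dimVec = d + A.dimVec :=
    ⟨_, (dimVec_subquotient_add_dimVec hAM).symm⟩
  have hle : d ≤ thinVec (interval τ a b) := by
    rw [← add_le_add_iff_right A.dimVec, ← hd, ← hdM]
    exact dimVec_mono hMB
  rw [hdM, charge_add, add_le_iff_nonpos_left]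
  refine hα.charge_nonpos hab hb (fun x hx => ?_) fun x hx y hy e => ?_
  · exact Nat.le_zero.1 ((hle x).trans_eq (thinVec_of_notMem hx))
  · rcases Nat.eq_zero_or_pos (d y) with hdy | hdy
    · have hAy : A.carrier y = M.carrier y := Submodule.eq_of_le_of_finrank_eq (hAM y)
        ((congrFun hdM y).trans (by rw [Pi.add_apply, hdy, zero_add]; rfl)).symm
      have hMx : M.carrier x ≤ A.carrier x := fun v hv =>
        hinj x hx y hy e v (hMB x hv) (hAy ▸ M.map_mem e v hv)
      have hdx : d x + A.dimVec x ≤ A.dimVec x :=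
        (congrFun hdM x).symm.trans_le (Submodule.finrank_mono hMx)
      omega
    · exact ((hle x).trans_eq (thinVec_of_mem hx)).trans hdy

/-- All interval modules are stable along `α`. -/
def TotallyStable (α : TypeA τ → ℝ) : Prop := ∀ a b, b ≤ ℓ + 1 → StableOn α a b

theorem totallyStable_iff_aboveChords {α : TypeA τ → ℝ} :
    TotallyStable α ↔
      AboveChords (IsForward τ) (height α) ℓ ∧ AboveChords (IsBackward τ) (-height α) ℓ := by
  simp only [AboveChords, bulge_neg, neg_pos]
  exact ⟨fun h => ⟨fun a c b hac hcb hb => (h a b hb c hac hcb).1,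
      fun a c b hac hcb hb => (h a b hb c hac hcb).2⟩,
    fun h a b hb c hac hcb => ⟨h.1 a c b hac hcb hb, h.2 a c b hac hcb hb⟩⟩

theorem totallyStable_iff_levelChain {α : TypeA τ → ℝ} :
    TotallyStable α ↔
      LevelChain (IsForward τ) (height α) ℓ ∧ LevelChain (IsBackward τ) (-height α) ℓ := by
  refine totallyStable_iff_aboveChords.trans
    ⟨fun h => ⟨h.1.levelChain, h.2.levelChain⟩, fun h => ⟨h.1.aboveChords ?_ h.2,
      h.2.aboveChords (q := IsForward τ) ?_ ((neg_neg (height α)).symm ▸ h.1)⟩⟩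
  · exact fun c hc => isForward_or_isBackward hc
  · exact fun c hc => (isForward_or_isBackward hc).symm

theorem induction_ite_eq_count {q : Fin ℓ → Prop} [DecidablePred q] {p : ℕ → Prop}
    [DecidablePred p] (hpq : ∀ i : Fin ℓ, q i ↔ p i) (x : Fin (ℓ + 1)) :
    Fin.induction (motive := fun _ => ℕ) 0 (fun i c => if q i then c + 1 else c) x =
      Nat.count p x := by
  induction x using Fin.induction with
  | zero => exact (Nat.count_zero p).symm
  | succ i ih =>
    rw [Fin.induction_succ, ih, Fin.val_succ, Nat.count_succ, Fin.val_castSucc,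
      if_congr (hpq i) rfl rfl]
    split_ifs <;> rfl

theorem chi_eq_count (x : TypeA τ) : chi τ x = Nat.count (IsForward τ) (idx x) :=
  induction_ite_eq_count (fun i => ⟨fun h => ⟨i.2, h⟩, fun h => h.2⟩) x

theorem eta_eq_count (x : TypeA τ) : eta τ x = Nat.count (IsBackward τ) (idx x) :=
  induction_ite_eq_count (fun i => ⟨fun h => ⟨i.2, h⟩, fun h => h.2⟩) x

theorem levelMin_le_and_le_levelMax_iff {f : TypeA τ → ℕ} (hf : Monotone f) {k : ℕ}
    (hk : ∃ x, f x = k) (x : TypeA τ) : levelMin f k ≤ x ∧ x ≤ levelMax f k ↔ f x = k := by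
  obtain ⟨y, hy⟩ := hk
  have hne : (Finset.univ.filter fun x => f x = k).Nonempty := ⟨y, (Finset.mem_filter_univ _).2 hy⟩
  refine ⟨fun ⟨hmin, hmax⟩ => ?_, fun hx => ?_⟩
  · obtain ⟨u, hu, hmin_eq⟩ := Finset.exists_mem_eq_inf _ hne (id : TypeA τ → TypeA τ)
    obtain ⟨v, hv, hmax_eq⟩ := Finset.exists_mem_eq_sup _ hne (id : TypeA τ → TypeA τ)
    have hux : f u ≤ f x := hf (hmin_eq.symm.trans_le hmin)
    have hxv : f x ≤ f v := hf (hmax.trans_eq hmax_eq)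
    rw [Finset.mem_filter_univ] at hu hv
    omega
  · have hmem : x ∈ Finset.univ.filter fun x => f x = k := (Finset.mem_filter_univ _).2 hx
    exact ⟨Finset.inf_le (f := id) hmem, Finset.le_sup (f := id) hmem⟩

theorem dimVec_levelModule (K : Type u) [Field K] {p : ℕ → Prop} [DecidablePred p]
    {f : TypeA τ → ℕ} (hf : ∀ x, f x = Nat.count p (idx x)) {k : ℕ} (hk : k ≤ Nat.count p ℓ) :
    (levelModule K f k).dimVec =
      thinVec (interval τ (levelStart p ℓ k) (levelStart p ℓ (k + 1))) := by
  have hlevel : ∀ x, f x = k ↔ x ∈ interval τ (levelStart p ℓ k) (levelStart p ℓ (k + 1)) := by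
    intro x
    have hx := idx_lt x
    rw [interval, Set.mem_preimage, Set.mem_Ico, ← not_lt, lt_levelStart_iff, lt_levelStart_iff, hf]
    omega
  have hmono : Monotone f := fun x y hxy => by
    rw [hf, hf]
    exact Nat.count_monotone p hxy
  have hne : ∃ x, f x = k := ⟨vertexAt τ (levelStart p ℓ k), (hlevel _).2
    (vertexAt_mem_interval (levelStart_le _) le_rfl (levelStart_lt_levelStart_succ hk))⟩
  exact funext fun x => finrank_pLift_fun K
    ((levelMin_le_and_le_levelMax_iff hmono hne x).trans (hlevel x))

theorem slope_levelModule (K : Type u) [Field K] (α : TypeA τ → ℝ) {p : ℕ → Prop}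
    [DecidablePred p] {f : TypeA τ → ℕ} (hf : ∀ x, f x = Nat.count p (idx x)) {k : ℕ}
    (hk : k ≤ Nat.count p ℓ) : slope α (levelModule K f k) = levelSlope p (height α) ℓ k := by
  have hslope : slope α (levelModule K f k) = dimSlope α (levelModule K f k).dimVec := rfl
  rw [hslope, dimVec_levelModule K hf hk,
    dimSlope_thinVec_interval α (levelStart_lt_levelStart_succ hk).le (levelStart_le _), levelSlope]

theorem totallyStable_iff_slope_levelModule (K : Type u) [Field K] {α : TypeA τ → ℝ} :
    TotallyStable α ↔
      (∀ k < chi τ (vertex τ (Fin.last ℓ)),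
        slope α (levelModule K (chi τ) k) > slope α (levelModule K (chi τ) (k + 1))) ∧
      (∀ k < eta τ (vertex τ (Fin.last ℓ)),
        slope α (levelModule K (eta τ) k) < slope α (levelModule K (eta τ) (k + 1))) := by
  have hlast : idx (vertex τ (Fin.last ℓ)) = ℓ := rfl
  rw [totallyStable_iff_levelChain, chi_eq_count, eta_eq_count, hlast]
  refine and_congr (forall₂_congr fun k hk => ?_) (forall₂_congr fun k hk => ?_)
  · rw [slope_levelModule K α chi_eq_count hk.le, slope_levelModule K α chi_eq_count hk]
  · rw [slope_levelModule K α eta_eq_count hk.le, slope_levelModule K α eta_eq_count hk]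
    simp only [levelSlope, chordSlope_neg, neg_lt_neg_iff]

end TypeA

/-! ### Complete central charges are totally stable -/

namespace QuiverRep

variable {K : Type u} [Field K] {Q : Type v} [Quiver.{w} Q] {I Y : Set Q}

open Classical in
/-- The representation with the vector space `K` at the vertices of `I` and `0` elsewhere, in
which each arrow `e` inside `I` acts by the scalar `s e`. -/
def thinRep (I : Set Q) (s : ∀ {x y : Q}, (x ⟶ y) → K) : QuiverRep K Q where
  obj x := PLift (x ∈ I) → K
  map {x y} e :=
    { toFun := fun f _ => if h : x ∈ I then s e * f ⟨h⟩ else 0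
      map_add' := fun f g => by
        funext _
        by_cases h : x ∈ I <;> simp [h, mul_add]
      map_smul' := fun c f => by
        funext _
        by_cases h : x ∈ I <;> simp [h, mul_left_comm] }

variable {s : ∀ {x y : Q}, (x ⟶ y) → K} {x y : Q}

theorem dimVec_thinRep : (thinRep I s).dimVec = thinVec I :=
  funext fun _ => finrank_pLift_fun K Iff.rfl

theorem thinRep_map_apply (e : x ⟶ y) (hx : x ∈ I) (hy : y ∈ I) (f : (thinRep I s).obj x) :
    (thinRep I s).map e f ⟨hy⟩ = s e * f ⟨hx⟩ := dif_pos hx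

theorem eq_zero_of_thinRep_map_eq_zero (e : x ⟶ y) (hx : x ∈ I) (hy : y ∈ I) (hs : s e ≠ 0)
    {f : (thinRep I s).obj x} (hf : (thinRep I s).map e f = 0) : f = 0 := by
  have h := congrFun hf ⟨hy⟩
  rw [thinRep_map_apply e hx hy] at h
  exact funext fun _ => (mul_eq_zero.1 h).resolve_left hs

open Classical in
/-- The subrepresentation of `V` which is all of `V` on a set `Y` of vertices that no arrow
leaves, and zero elsewhere. -/
def Subrep.supportedOn (V : QuiverRep K Q) (hY : ∀ x y : Q, (x ⟶ y) → x ∈ Y → y ∈ Y) :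
    Subrep V where
  carrier x := if x ∈ Y then ⊤ else ⊥
  map_mem {x y} e v hv := by
    by_cases h : x ∈ Y
    · rw [if_pos (hY x y e h)]
      exact Submodule.mem_top
    · rw [if_neg h, Submodule.mem_bot] at hv
      rw [hv, map_zero]
      exact zero_mem _

variable {V : QuiverRep K Q} (hY : ∀ x y : Q, (x ⟶ y) → x ∈ Y → y ∈ Y)

theorem Subrep.carrier_supportedOn_of_mem (hx : x ∈ Y) : (supportedOn V hY).carrier x = ⊤ :=
  if_pos hx

theorem Subrep.carrier_supportedOn_of_notMem (hx : x ∉ Y) : (supportedOn V hY).carrier x = ⊥ :=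
  if_neg hx

theorem Subrep.dimVec_supportedOn_thinRep :
    (supportedOn (thinRep I s) hY).dimVec = thinVec (I ∩ Y) := by
  funext x
  change Module.finrank K ((supportedOn (thinRep I s) hY).carrier x) = _
  by_cases hx : x ∈ Y
  · rw [carrier_supportedOn_of_mem hY hx, finrank_top]
    exact finrank_pLift_fun K (and_iff_left hx).symm
  · rw [carrier_supportedOn_of_notMem hY hx, finrank_bot, thinVec_of_notMem fun h => hx h.2]

end QuiverRep

namespace TypeA

open QuiverRep QuiverRep.Subrep

variable {ℓ : ℕ} {τ : Fin ℓ → Bool} {K : Type u} [Field K] {α : TypeA τ → ℝ}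
  {I Y : Set (TypeA τ)} {a b c d : ℕ}

theorem isHNType_thinRep (hY : ∀ x y : TypeA τ, (x ⟶ y) → x ∈ Y → y ∈ Y)
    (hsub : I ∩ Y = interval τ a b) (hquot : I \ Y = interval τ c d) (hab : a < b)
    (hb : b ≤ ℓ + 1) (hcd : c < d) (hd : d ≤ ℓ + 1) (hαab : StableOn α a b)
    (hαcd : StableOn α c d) (hle : chordSlope (height α) c d ≤ chordSlope (height α) a b)
    {s : ∀ {x y : TypeA τ}, (x ⟶ y) → K}
    (hs : ∀ {x y} (e : x ⟶ y), (x ∈ Y ↔ y ∈ Y) → s e ≠ 0) :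
    (thinRep I s).IsHNType α
      (if chordSlope (height α) c d < chordSlope (height α) a b then
        [thinVec (interval τ a b), thinVec I - thinVec (interval τ a b)] else [thinVec I]) := by
  set R := supportedOn (thinRep I s) hY
  have hR : R.dimVec = thinVec (interval τ a b) := hsub ▸ dimVec_supportedOn_thinRep hY
  have hI : (⊤ : Subrep (thinRep I s)).dimVec = thinVec (interval τ c d) + R.dimVec := by
    rw [dimVec_top, dimVec_thinRep, hR, ← hsub, ← hquot, add_comm, thinVec_inter_add_thinVec_diff]
  have hbotR : ⊥ < R := bot_lt_iff_ne_bot.2 fun h =>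
    thinVec_interval_ne_zero hab hb (by rw [← hR, h, dimVec_bot])
  have hRtop : R < ⊤ := lt_top_iff_ne_top.2 fun h =>
    thinVec_interval_ne_zero hcd hd (by rwa [h, right_eq_add] at hI)
  have hss₁ : SemistableBetween α (chordSlope (height α) a b) ⊥ R := by
    refine hαab.semistableBetween hab hb bot_le (by rw [dimVec_bot, add_zero, hR]) ?_
    rw [← hsub]
    intro x hx y hy e v _ hv
    exact eq_zero_of_thinRep_map_eq_zero e hx.1 hy.1 (hs e (iff_of_true hx.2 hy.2)) hv
  have hss₂ : SemistableBetween α (chordSlope (height α) c d) R ⊤ := by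
    refine hαcd.semistableBetween hcd hd le_top hI ?_
    rw [← hquot]
    intro x hx y hy e v _ hv
    rw [carrier_supportedOn_of_notMem hY hy.2] at hv
    rw [eq_zero_of_thinRep_map_eq_zero e hx.1 hy.1 (hs e (iff_of_false hx.2 hy.2)) hv]
    exact zero_mem _
  have hHN := isHNType_of_semistableBetween hbotR hRtop hss₁ hss₂ hle
  rwa [hR, dimVec_thinRep] at hHN

/-- If the slopes were ordered the other way, a nonsplit extension of the two interval modules
would have the same Harder-Narasimhan type as their direct sum. -/
theorem chordSlope_lt_of_isCompleteCharge (hα : IsCompleteCharge K α)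
    (hY : ∀ x y : TypeA τ, (x ⟶ y) → x ∈ Y → y ∈ Y)
    (hsub : I ∩ Y = interval τ a b) (hquot : I \ Y = interval τ c d)
    (hb : b ≤ ℓ + 1) (hd : d ≤ ℓ + 1) (hαab : StableOn α a b) (hαcd : StableOn α c d)
    {x y : TypeA τ} (e : x ⟶ y) (hx : x ∈ interval τ c d) (hy : y ∈ interval τ a b) :
    chordSlope (height α) a b < chordSlope (height α) c d := by
  classical
  by_contra! hle
  have hab : a < b := hy.1.trans_lt hy.2
  have hcd : c < d := hx.1.trans_lt hx.2
  let split : ∀ {x y : TypeA τ}, (x ⟶ y) → K := fun {x y} _ => if x ∈ Y ↔ y ∈ Y then 1 else 0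
  obtain ⟨φ, hφ⟩ := hα (thinRep I fun _ => 1) (thinRep I split) ⟨_,
    isHNType_thinRep hY hsub hquot hab hb hcd hd hαab hαcd hle fun _ _ => one_ne_zero,
    isHNType_thinRep hY hsub hquot hab hb hcd hd hαab hαcd hle fun _ h =>
      (if_pos h).trans_ne one_ne_zero⟩
  rw [← hquot] at hx
  rw [← hsub] at hy
  have hsplit : ∀ v, (thinRep I split).map e v = 0 := fun v => funext fun i => by
    have hzero : split e = 0 := if_neg fun h => hx.2 (h.2 hy.2)
    rw [thinRep_map_apply e hx.1 i.down, hzero, zero_mul]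
    rfl
  have hmap := hφ x y e fun _ => 1
  rw [hsplit, LinearEquiv.map_eq_zero_iff] at hmap
  have hone := eq_zero_of_thinRep_map_eq_zero e hx.1 hy.1 one_ne_zero hmap
  exact one_ne_zero (congrFun hone ⟨hx.1⟩)

theorem interval_inter_setOf_le (hac : a ≤ c) :
    interval τ a b ∩ {x | c ≤ idx x} = interval τ c b := by
  ext x
  simp only [interval, Set.mem_inter_iff, Set.mem_preimage, Set.mem_Ico, Set.mem_ofPred_eq]
  omega

theorem interval_inter_setOf_lt (hcb : c ≤ b) :
    interval τ a b ∩ {x | idx x < c} = interval τ a c := by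
  ext x
  simp only [interval, Set.mem_inter_iff, Set.mem_preimage, Set.mem_Ico, Set.mem_ofPred_eq]
  omega

theorem setOf_succ_le_idx_closed (hc : IsForward τ c) (x y : TypeA τ) (e : x ⟶ y)
    (hx : x ∈ {x : TypeA τ | c + 1 ≤ idx x}) : y ∈ {x : TypeA τ | c + 1 ≤ idx x} := by
  rw [Set.mem_ofPred_eq] at *
  rcases arrow_cases e with ⟨hxy, -⟩ | ⟨hxy, hback⟩
  · omega
  · by_contra! hlt
    obtain rfl : idx y = c := by omega
    exact hc.not_isBackward hback

theorem setOf_idx_lt_succ_closed (hc : IsBackward τ c) (x y : TypeA τ) (e : x ⟶ y)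
    (hx : x ∈ {x : TypeA τ | idx x < c + 1}) : y ∈ {x : TypeA τ | idx x < c + 1} := by
  rw [Set.mem_ofPred_eq] at *
  rcases arrow_cases e with ⟨hxy, hfwd⟩ | ⟨hxy, -⟩
  · by_contra! hle
    obtain rfl : idx x = c := by omega
    exact hfwd.not_isBackward hc
  · omega

theorem totallyStable_of_isCompleteCharge (hα : IsCompleteCharge K α) : TotallyStable α := by
  intro a b hb
  induction hn : b - a using Nat.strong_induction_on generalizing a b with
  | _ n ih =>
    intro c hac hcb
    have hleft : StableOn α a (c + 1) := ih _ (by omega) a (c + 1) (by omega) rfl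
    have hright : StableOn α (c + 1) b := ih _ (by omega) (c + 1) b hb rfl
    have hinterL : interval τ a b ∩ {x | idx x < c + 1} = interval τ a (c + 1) :=
      interval_inter_setOf_lt hcb.le
    have hinterR : interval τ a b ∩ {x | c + 1 ≤ idx x} = interval τ (c + 1) b :=
      interval_inter_setOf_le (by omega)
    have hx : idx (vertexAt τ c) = c := idx_vertexAt (by omega)
    have hxy : idx (vertexAt τ (c + 1)) = idx (vertexAt τ c) + 1 := by
      rw [hx, idx_vertexAt (by omega)]
    have hxmem : vertexAt τ c ∈ interval τ a (c + 1) :=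
      vertexAt_mem_interval (by omega) hac c.lt_succ_self
    have hymem : vertexAt τ (c + 1) ∈ interval τ (c + 1) b := vertexAt_mem_interval hb le_rfl hcb
    refine ⟨fun hc => ?_, fun hc => ?_⟩
    · obtain ⟨e⟩ := IsForward.nonempty_hom (hx.symm ▸ hc) hxy
      rw [bulge_pos_iff (by omega) hcb]
      refine chordSlope_lt_of_isCompleteCharge hα (setOf_succ_le_idx_closed hc) hinterR ?_ hb
        (by omega) hright hleft e hxmem hymem
      rw [← hinterL, Set.sdiff_eq]
      simp only [Set.compl_ofPred, not_le]
    · obtain ⟨e⟩ := IsBackward.nonempty_hom (hx.symm ▸ hc) hxy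
      rw [← neg_pos, ← bulge_neg, bulge_pos_iff (by omega) hcb, chordSlope_neg, chordSlope_neg,
        neg_lt_neg_iff]
      refine chordSlope_lt_of_isCompleteCharge hα (setOf_idx_lt_succ_closed hc) hinterL ?_
        (by omega) hb hleft hright e hymem hxmem
      rw [← hinterR, Set.sdiff_eq]
      simp only [Set.compl_ofPred, not_lt]

end TypeA

/-! ### Decompositions into thin representations -/

theorem exists_dual_comp_eq {K E F : Type*} [Field K] [AddCommGroup E] [Module K E]
    [AddCommGroup F] [Module K F] (f : E →ₗ[K] F) (Z : Submodule K F) (φ : E →ₗ[K] K)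
    (h : Z.comap f ≤ LinearMap.ker φ) :
    ∃ ψ : F →ₗ[K] K, Z ≤ LinearMap.ker ψ ∧ ψ ∘ₗ f = φ := by
  have hφ : φ ∈ LinearMap.range (Z.mkQ ∘ₗ f).dualMap := by
    rwa [LinearMap.range_dualMap_eq_dualAnnihilator_ker, Submodule.mem_dualAnnihilator,
      LinearMap.ker_comp, Submodule.ker_mkQ]
  obtain ⟨ψ, hψ⟩ := hφ
  refine ⟨ψ ∘ₗ Z.mkQ, fun z hz => ?_, hψ⟩
  rw [LinearMap.mem_ker, LinearMap.comp_apply, Submodule.mkQ_apply,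
    (Submodule.Quotient.mk_eq_zero Z).2 hz, map_zero]

theorem exists_dual_eq_one {K F : Type*} [Field K] [AddCommGroup F] [Module K F]
    (Z : Submodule K F) {v : F} (hv : v ∉ Z) :
    ∃ ψ : F →ₗ[K] K, Z ≤ LinearMap.ker ψ ∧ ψ v = 1 := by
  obtain ⟨ψ, hv, hZ⟩ := Submodule.exists_le_ker_of_notMem hv
  refine ⟨(ψ v)⁻¹ • ψ, fun z hz => ?_, inv_mul_cancel₀ hv⟩
  rw [LinearMap.mem_ker, LinearMap.smul_apply, hZ hz, smul_zero]

namespace QuiverRep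

open Subrep

variable {K : Type u} [Field K] {Q : Type v} [Quiver.{w} Q]

/-- The vectors `v` and the functionals `φ` split off, from the restriction of `V` to the full
subquiver on `Y`, a direct summand with basis `v x` for `x ∈ I` on which all arrows inside `I`
act as the identity. -/
structure IsSummandOn (V : QuiverRep K Q) (Y I : Set Q) (v : ∀ x, V.obj x)
    (φ : ∀ x, V.obj x →ₗ[K] K) : Prop where
  vec_eq_zero : ∀ x ∉ I, v x = 0
  coord_eq_zero : ∀ x ∉ I, φ x = 0
  coord_vec : ∀ x ∈ I, φ x (v x) = 1
  map_vec : ∀ x ∈ I, ∀ y ∈ Y, ∀ e : x ⟶ y, V.map e (v x) = v y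
  coord_map : ∀ x ∈ Y, ∀ y ∈ I, ∀ e : x ⟶ y, φ y ∘ₗ V.map e = φ x

variable {V W : QuiverRep K Q} {Y I : Set Q} {v : ∀ x, V.obj x} {φ : ∀ x, V.obj x →ₗ[K] K}

theorem isSummandOn_empty (V : QuiverRep K Q) (Y : Set Q) : IsSummandOn V Y ∅ 0 0 where
  vec_eq_zero _ _ := rfl
  coord_eq_zero _ _ := rfl
  coord_vec _ hx := hx.elim
  map_vec _ hx := hx.elim
  coord_map _ _ _ hy := hy.elim

theorem IsSummandOn.exists_insert (h : IsSummandOn V Y I v φ) (hIY : I ⊆ Y) {x₁ : Q}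
    (hx₁ : x₁ ∉ Y) (hloop : IsEmpty (x₁ ⟶ x₁)) {w : V.obj x₁} {ψ : V.obj x₁ →ₗ[K] K}
    (hψw : ψ w = 1)
    (hin : ∀ x ∈ Y, ∀ e : x ⟶ x₁, ψ ∘ₗ V.map e = φ x ∧ (x ∈ I → V.map e (v x) = w))
    (hout : ∀ y ∈ Y, ∀ e : x₁ ⟶ y, V.map e w = v y ∧ (y ∈ I → φ y ∘ₗ V.map e = ψ)) :
    ∃ v' φ', IsSummandOn V (insert x₁ Y) (insert x₁ I) v' φ' ∧ v' x₁ = w ∧ φ' x₁ = ψ := by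
  classical
  have hne : ∀ {x}, x ∈ Y → x ≠ x₁ := fun hx => ne_of_mem_of_not_mem hx hx₁
  refine ⟨Function.update v x₁ w, Function.update φ x₁ ψ, ⟨fun x hx => ?_, fun x hx => ?_,
    fun x hx => ?_, fun x hx y hy e => ?_, fun x hx y hy e => ?_⟩, Function.update_self ..,
    Function.update_self ..⟩
  · rw [Set.mem_insert_iff, not_or] at hx
    rw [Function.update_of_ne hx.1, h.vec_eq_zero x hx.2]
  · rw [Set.mem_insert_iff, not_or] at hx
    rw [Function.update_of_ne hx.1, h.coord_eq_zero x hx.2]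
  · rcases hx with rfl | hx
    · rwa [Function.update_self, Function.update_self]
    · rw [Function.update_of_ne (hne (hIY hx)), Function.update_of_ne (hne (hIY hx))]
      exact h.coord_vec x hx
  · rcases hx with rfl | hx <;> rcases hy with rfl | hy
    · exact hloop.elim e
    · rw [Function.update_self, Function.update_of_ne (hne hy), (hout y hy e).1]
    · rw [Function.update_self, Function.update_of_ne (hne (hIY hx)), (hin x (hIY hx) e).2 hx]
    · rw [Function.update_of_ne (hne (hIY hx)), Function.update_of_ne (hne hy)]
      exact h.map_vec x hx y hy e
  · rcases hx with rfl | hx <;> rcases hy with rfl | hy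
    · exact hloop.elim e
    · rw [Function.update_self, Function.update_of_ne (hne (hIY hy)), (hout y (hIY hy) e).2 hy]
    · rw [Function.update_self, Function.update_of_ne (hne hx), (hin x hx e).1]
    · rw [Function.update_of_ne (hne hx), Function.update_of_ne (hne (hIY hy))]
      exact h.coord_map x hx y hy e

/-- The vectors `v` and the functionals `φ` split off a direct summand of `V` with basis `v x` for
`x ∈ I` on which all arrows inside `I` act as the identity. -/
abbrev IsSummand (V : QuiverRep K Q) (I : Set Q) (v : ∀ x, V.obj x)
    (φ : ∀ x, V.obj x →ₗ[K] K) : Prop := IsSummandOn V Set.univ I v φ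

theorem IsSummandOn.isSummand (h : IsSummandOn V Y I v φ)
    (hV : ∀ x ∉ Y, Subsingleton (V.obj x)) : IsSummand V I v φ where
  vec_eq_zero := h.vec_eq_zero
  coord_eq_zero := h.coord_eq_zero
  coord_vec := h.coord_vec
  map_vec x hx y _ e := by
    by_cases hy : y ∈ Y
    · exact h.map_vec x hx y hy e
    · have := hV y hy
      exact Subsingleton.elim _ _
  coord_map x _ y hy e := by
    by_cases hx : x ∈ Y
    · exact h.coord_map x hx y hy e
    · have := hV x hx
      exact LinearMap.ext fun u => by rw [Subsingleton.elim u 0, map_zero, map_zero]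

namespace IsSummand

theorem map_vec (h : IsSummand V I v φ) {x y : Q} (e : x ⟶ y) (hx : x ∈ I) :
    V.map e (v x) = v y := IsSummandOn.map_vec h x hx y (Set.mem_univ y) e

theorem coord_map (h : IsSummand V I v φ) {x y : Q} (e : x ⟶ y) (hy : y ∈ I) (u : V.obj x) :
    φ y (V.map e u) = φ x u :=
  LinearMap.congr_fun (IsSummandOn.coord_map h x (Set.mem_univ x) y hy e) u

theorem coord_map_smul_vec (h : IsSummand V I v φ) {v' : ∀ x, W.obj x}
    {φ' : ∀ x, W.obj x →ₗ[K] K} (h' : IsSummand W I v' φ') {x y : Q} (e : x ⟶ y) (u : V.obj x) :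
    φ y (V.map e u) • v' y = W.map e (φ x u • v' x) := by
  rw [map_smul]
  by_cases hx : x ∈ I
  · rw [map_vec h' e hx]
    by_cases hy : y ∈ I
    · rw [coord_map h e hy]
    · rw [h'.vec_eq_zero y hy, smul_zero, smul_zero]
  · rw [h.coord_eq_zero x hx, LinearMap.zero_apply, zero_smul]
    by_cases hy : y ∈ I
    · rw [coord_map h e hy, h.coord_eq_zero x hx, LinearMap.zero_apply, zero_smul]
    · rw [h'.vec_eq_zero y hy, smul_zero]

theorem coord_smul_vec (h : IsSummand V I v φ) (x : Q) (u : V.obj x) :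
    φ x (φ x u • v x) = φ x u := by
  by_cases hx : x ∈ I
  · rw [map_smul, h.coord_vec x hx, smul_eq_mul, mul_one]
  · rw [h.coord_eq_zero x hx]
    rfl

/-- The direct summand itself. -/
def line (h : IsSummand V I v φ) : Subrep V where
  carrier x := Submodule.span K {v x}
  map_mem {x y} e u hu := by
    obtain ⟨t, rfl⟩ := Submodule.mem_span_singleton.1 hu
    by_cases hx : x ∈ I
    · rw [map_smul, map_vec h e hx]
      exact Submodule.smul_mem _ _ (Submodule.mem_span_singleton_self _)
    · rw [h.vec_eq_zero x hx, smul_zero, map_zero]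
      exact zero_mem _

theorem dimVec_line (h : IsSummand V I v φ) : h.line.dimVec = thinVec I := by
  funext x
  change Module.finrank K (Submodule.span K {v x}) = _
  by_cases hx : x ∈ I
  · have hne : v x ≠ 0 := fun h0 => by simpa [h0] using h.coord_vec x hx
    rw [thinVec_of_mem hx, finrank_span_singleton hne]
  · rw [thinVec_of_notMem hx, h.vec_eq_zero x hx, Submodule.span_zero_singleton, finrank_bot]

/-- The complement of a direct summand. -/
def compl (h : IsSummand V I v φ) : Subrep V where
  carrier x := LinearMap.ker (φ x)
  map_mem {x y} e u hu := by
    by_cases hy : y ∈ I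
    · rwa [LinearMap.mem_ker, coord_map h e hy]
    · rw [h.coord_eq_zero y hy]
      rfl

theorem thinVec_add_dimVec_compl (h : IsSummand V I v φ) :
    thinVec I + h.compl.dimVec = V.dimVec := by
  funext x
  change _ + Module.finrank K (LinearMap.ker (φ x)) = Module.finrank K (V.obj x)
  rw [← LinearMap.finrank_range_add_finrank_ker (φ x), add_left_inj]
  by_cases hx : x ∈ I
  · have hsurj : LinearMap.range (φ x) = ⊤ := LinearMap.range_eq_top.2 fun t =>
      ⟨t • v x, by rw [map_smul, h.coord_vec x hx, smul_eq_mul, mul_one]⟩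
    rw [thinVec_of_mem hx, hsurj, finrank_top, Module.finrank_self]
  · rw [thinVec_of_notMem hx, h.coord_eq_zero x hx, LinearMap.range_zero, finrank_bot]

/-- The projection to the complement of a direct summand. -/
def proj (h : IsSummand V I v φ) (x : Q) : V.obj x →ₗ[K] h.compl.carrier x :=
  (LinearMap.id - (φ x).smulRight (v x)).codRestrict _ fun u => by
    change φ x (u - φ x u • v x) = 0
    rw [map_sub, h.coord_smul_vec, sub_self]

theorem coe_proj (h : IsSummand V I v φ) (x : Q) (u : V.obj x) :
    (h.proj x u : V.obj x) = u - φ x u • v x := rfl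

theorem proj_coe (h : IsSummand V I v φ) (x : Q) (u : h.compl.carrier x) :
    h.proj x u = u := by
  have hu : φ x u = 0 := u.2
  exact Subtype.ext (by rw [coe_proj, hu, zero_smul, sub_zero])

theorem proj_vec (h : IsSummand V I v φ) (x : Q) : h.proj x (v x) = 0 := by
  by_cases hx : x ∈ I
  · exact Subtype.ext (by rw [coe_proj, h.coord_vec x hx, one_smul, sub_self]; rfl)
  · rw [h.vec_eq_zero x hx, map_zero]

theorem proj_map (h : IsSummand V I v φ) {x y : Q} (e : x ⟶ y) (u : V.obj x) :
    h.proj y (V.map e u) = h.compl.toRep.map e (h.proj x u) := by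
  refine Subtype.ext ?_
  change V.map e u - φ y (V.map e u) • v y = V.map e (u - φ x u • v x)
  rw [h.coord_map_smul_vec h, map_sub]

theorem lift (h : IsSummand V I v φ) {I' : Set Q} {v' : ∀ x, h.compl.toRep.obj x}
    {φ' : ∀ x, h.compl.toRep.obj x →ₗ[K] K} (h' : IsSummand h.compl.toRep I' v' φ') :
    IsSummand V I' (fun x => (v' x : h.compl.carrier x).1) fun x => φ' x ∘ₗ h.proj x where
  vec_eq_zero x hx := congrArg Subtype.val (h'.vec_eq_zero x hx)
  coord_eq_zero x hx := by rw [h'.coord_eq_zero x hx]; rfl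
  coord_vec x hx := (congrArg (φ' x) (h.proj_coe x (v' x))).trans (h'.coord_vec x hx)
  map_vec x hx y _ e := congrArg Subtype.val (map_vec h' e hx)
  coord_map x _ y hy e := LinearMap.ext fun u =>
    (congrArg (φ' y) (h.proj_map e u)).trans (coord_map h' e hy _)

end IsSummand

/-- A decomposition of `V`, indexed by `J`, into direct summands which are one-dimensional on the
set `supp j` and zero off it, all arrows inside `supp j` acting as the identity. -/
structure ThinDecomp (V : QuiverRep K Q) (J : Type) [Fintype J] where
  /-- the vertices at which a summand is nonzero -/
  supp : J → Set Q
  /-- the basis vectors -/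
  vec : J → ∀ x, V.obj x
  /-- the coordinates -/
  coord : J → ∀ x, V.obj x →ₗ[K] K
  isSummand : ∀ j, IsSummand V (supp j) (vec j) (coord j)
  coord_vec_of_ne : ∀ i j x, i ≠ j → coord i x (vec j x) = 0
  sum_coord : ∀ x v, ∑ j, coord j x v • vec j x = v

/-- The decomposition of the zero representation into no summands. -/
def ThinDecomp.ofSubsingleton (h : ∀ x, Subsingleton (V.obj x)) : ThinDecomp V Empty where
  supp := Empty.elim
  vec j := j.elim
  coord j := j.elim
  isSummand j := j.elim
  coord_vec_of_ne i := i.elim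
  sum_coord x _ := (h x).elim _ _

/-- A decomposition of the complement of a direct summand yields one of the whole. -/
def IsSummand.decomp (h : IsSummand V I v φ) {J : Type} [Fintype J]
    (D : ThinDecomp h.compl.toRep J) : ThinDecomp V (Option J) where
  supp j := j.elim I D.supp
  vec j x := j.elim (v x) fun i => (D.vec i x : h.compl.carrier x).1
  coord j x := j.elim (φ x) fun i => D.coord i x ∘ₗ h.proj x
  isSummand j := match j with
    | none => h
    | some i => h.lift (D.isSummand i)
  coord_vec_of_ne i j x hij := match i, j with
    | none, none => (hij rfl).elim
    | none, some j => (D.vec j x : h.compl.carrier x).2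
    | some i, none => (congrArg (D.coord i x) (h.proj_vec x)).trans (map_zero _)
    | some i, some j => (congrArg (D.coord i x) (h.proj_coe x (D.vec j x))).trans
        (D.coord_vec_of_ne i j x fun hij' => hij (congrArg some hij'))
  sum_coord x u := by
    rw [Fintype.sum_option]
    refine Eq.trans (congrArg (φ x u • v x + ·) ?_) (add_sub_cancel _ u)
    exact (map_sum (h.compl.carrier x).subtype (fun i => D.coord i x (h.proj x u) • D.vec i x)
      Finset.univ).symm.trans (congrArg Subtype.val (D.sum_coord x (h.proj x u)))

namespace ThinDecomp

variable {J : Type} [Fintype J]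

theorem coord_sum_smul_vec (D : ThinDecomp V J) (x : Q) (t : J → K) (j : J) :
    D.coord j x (∑ i, t i • D.vec i x) = t j * D.coord j x (D.vec j x) := by
  rw [map_sum, Finset.sum_eq_single j, map_smul, smul_eq_mul]
  · intro i _ hij
    rw [map_smul, D.coord_vec_of_ne j i x hij.symm, smul_zero]
  · exact fun hj => (hj (Finset.mem_univ j)).elim

open Classical in
theorem finrank_eq_card (D : ThinDecomp V J) {x : Q} {P : J → Prop} {M : Submodule K (V.obj x)}
    (hvec : ∀ j, P j → D.vec j x ∈ M) (hcoord : ∀ j, ¬P j → M ≤ LinearMap.ker (D.coord j x)) :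
    Module.finrank K M = Finset.card {j | P j ∧ x ∈ D.supp j} := by
  have hspan : M = Submodule.span K
      (Set.range fun j : {j // P j ∧ x ∈ D.supp j} => D.vec j x) := by
    refine le_antisymm (fun u hu => ?_) (Submodule.span_le.2 ?_)
    · rw [← D.sum_coord x u]
      refine Submodule.sum_mem _ fun j _ => ?_
      by_cases hj : P j
      · by_cases hx : x ∈ D.supp j
        · exact Submodule.smul_mem _ _ (Submodule.subset_span ⟨⟨j, hj, hx⟩, rfl⟩)
        · rw [(D.isSummand j).vec_eq_zero x hx, smul_zero]
          exact zero_mem _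
      · rw [hcoord j hj hu, zero_smul]
        exact zero_mem _
    · rintro _ ⟨j, rfl⟩
      exact hvec j j.2.1
  have hli : LinearIndependent K fun j : {j // P j ∧ x ∈ D.supp j} => D.vec j x := by
    rw [Fintype.linearIndependent_iff]
    intro g hg i
    have hi := congrArg (D.coord i x) hg
    rw [map_zero, map_sum, Finset.sum_eq_single i] at hi
    · rwa [map_smul, (D.isSummand i).coord_vec x i.2.2, smul_eq_mul, mul_one] at hi
    · intro j _ hji
      rw [map_smul, D.coord_vec_of_ne i j x fun h => hji (Subtype.ext h.symm), smul_zero]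
    · exact fun hi => (hi (Finset.mem_univ i)).elim
  rw [hspan, finrank_span_eq_card hli, Fintype.card_subtype]

/-- A decomposition with its summands reindexed. -/
def reindex {J' : Type} [Fintype J'] (D : ThinDecomp V J') (σ : J ≃ J') : ThinDecomp V J where
  supp j := D.supp (σ j)
  vec j := D.vec (σ j)
  coord j := D.coord (σ j)
  isSummand j := D.isSummand (σ j)
  coord_vec_of_ne _ _ x hij := D.coord_vec_of_ne _ _ x fun h => hij (σ.injective h)
  sum_coord x v := (Equiv.sum_comp σ fun j => D.coord j x v • D.vec j x).trans (D.sum_coord x v)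

/-- The map between two decomposed representations which maps basis vectors to basis vectors. -/
def transfer (D : ThinDecomp V J) (D' : ThinDecomp W J) (x : Q) : V.obj x →ₗ[K] W.obj x :=
  ∑ j, (D.coord j x).smulRight (D'.vec j x)

theorem transfer_apply (D : ThinDecomp V J) (D' : ThinDecomp W J) (x : Q) (u : V.obj x) :
    D.transfer D' x u = ∑ j, D.coord j x u • D'.vec j x := by
  simp only [transfer, LinearMap.sum_apply, LinearMap.smulRight_apply]

theorem transfer_transfer (D : ThinDecomp V J) (D' : ThinDecomp W J)
    (hsupp : ∀ j, D.supp j = D'.supp j) (x : Q) (u : V.obj x) :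
    D'.transfer D x (D.transfer D' x u) = u := by
  conv_rhs => rw [← D.sum_coord x u]
  rw [transfer_apply, transfer_apply]
  refine Finset.sum_congr rfl fun j _ => ?_
  rw [D'.coord_sum_smul_vec]
  by_cases hx : x ∈ D.supp j
  · rw [(D'.isSummand j).coord_vec x (hsupp j ▸ hx), mul_one]
  · rw [(D.isSummand j).vec_eq_zero x hx, smul_zero, smul_zero]

theorem transfer_map (D : ThinDecomp V J) (D' : ThinDecomp W J)
    (hsupp : ∀ j, D.supp j = D'.supp j) {x y : Q} (e : x ⟶ y) (u : V.obj x) :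
    D.transfer D' y (V.map e u) = W.map e (D.transfer D' x u) := by
  rw [transfer_apply, transfer_apply, map_sum]
  exact Finset.sum_congr rfl fun j _ =>
    (D.isSummand j).coord_map_smul_vec (hsupp j ▸ D'.isSummand j) e u

theorem isomorphic (D : ThinDecomp V J) (D' : ThinDecomp W J)
    (hsupp : ∀ j, D.supp j = D'.supp j) : V.Isomorphic W :=
  ⟨fun x => LinearEquiv.ofLinearMap (D.transfer D' x) (D'.transfer D x)
    (LinearMap.ext fun u => D'.transfer_transfer D (fun j => (hsupp j).symm) x u)
    (LinearMap.ext fun u => D.transfer_transfer D' hsupp x u),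
    fun _ _ e u => D.transfer_map D' hsupp e u⟩

end ThinDecomp

end QuiverRep

theorem exists_dual_comp_eq_zero_of_comap_le {K E F : Type*} [Field K] [AddCommGroup E]
    [Module K E] [AddCommGroup F] [Module K F] (f : E →ₗ[K] F) {Z R : Submodule K F} (hZR : Z < R)
    (h : R.comap f ≤ Z.comap f) :
    ∃ w ∈ R, ∃ ψ : F →ₗ[K] K, Z ≤ LinearMap.ker ψ ∧ ψ ∘ₗ f = 0 ∧ ψ w = 1 := by
  have hR : ¬R ≤ Z ⊔ LinearMap.range f := fun hR => hZR.not_ge <| by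
    have hmod := sup_inf_assoc_of_le (LinearMap.range f) hZR.le
    rw [inf_eq_right.2 hR] at hmod
    rw [hmod]
    refine sup_le le_rfl ?_
    rintro _ ⟨⟨u, rfl⟩, hu⟩
    exact h hu
  obtain ⟨w, hwR, hw⟩ := SetLike.not_le_iff_exists.1 hR
  obtain ⟨ψ, hψ, hψw⟩ := exists_dual_eq_one _ hw
  obtain ⟨hZ, hf⟩ := sup_le_iff.1 hψ
  exact ⟨w, hwR, ψ, hZ, LinearMap.range_le_ker_iff.1 hf, hψw⟩

theorem exists_dual_of_map_le {K E F : Type*} [Field K] [AddCommGroup E] [Module K E]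
    [AddCommGroup F] [Module K F] (f : F →ₗ[K] E) {Z R : Submodule K F} (hZR : Z < R)
    (h : R.map f ≤ Z.map f) :
    ∃ w ∈ R, f w = 0 ∧ ∃ ψ : F →ₗ[K] K, Z ≤ LinearMap.ker ψ ∧ ψ w = 1 := by
  have hR : ¬LinearMap.ker f ⊓ R ≤ Z := fun hR => hZR.not_ge <| by
    have hmod := sup_inf_assoc_of_le (LinearMap.ker f) hZR.le
    rw [Submodule.map_le_iff_le_comap, Submodule.comap_map_eq] at h
    rw [inf_eq_right.2 h] at hmod
    rw [hmod]
    exact sup_le le_rfl hR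
  obtain ⟨w, ⟨hfw, hwR⟩, hw⟩ := SetLike.not_le_iff_exists.1 hR
  exact ⟨w, hwR, hfw, exists_dual_eq_one Z hw⟩

namespace TypeA

open QuiverRep QuiverRep.Subrep

variable {ℓ : ℕ} {τ : Fin ℓ → Bool}

theorem Arrow.heq {x y x' y' : Fin (ℓ + 1)} (e : Arrow τ x y) (e' : Arrow τ x' y') (hx : x = x')
    (hy : y = y') : e ≍ e' := by
  cases e <;> cases e'
  case forward.forward => cases Fin.castSucc_injective _ hx; rfl
  case backward.backward => cases Fin.castSucc_injective _ hy; rfl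
  all_goals
    simp only [Fin.ext_iff, Fin.val_castSucc, Fin.val_succ] at hx hy
    omega

instance (x y : TypeA τ) : Subsingleton (x ⟶ y) :=
  ⟨fun e e' => eq_of_heq (Arrow.heq e e' rfl rfl)⟩

theorem interval_self (n : ℕ) : interval τ n n = ∅ := by
  rw [interval, Set.Ico_self, Set.preimage_empty]

theorem interval_idx_succ {a : ℕ} {x : TypeA τ} (ha : a ≤ idx x) :
    interval τ a (idx x + 1) = insert x (interval τ a (idx x)) := by
  ext y
  rw [Set.mem_insert_iff, ← idx_injective.eq_iff, interval, interval, Set.mem_preimage,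
    Set.mem_preimage, Set.mem_Ico, Set.mem_Ico]
  omega

variable {K : Type u} [Field K] {V : QuiverRep K (TypeA τ)} {v : ∀ x, V.obj x}
  {φ : ∀ x, V.obj x →ₗ[K] K} {a : ℕ} {x₀ x₁ : TypeA τ} {w : V.obj x₁} {ψ : V.obj x₁ →ₗ[K] K}

theorem exists_isSummandOn_succ
    (h : IsSummandOn V (interval τ 0 (idx x₁)) (interval τ a (idx x₁)) v φ) (ha : a ≤ idx x₁)
    (hψw : ψ w = 1)
    (hin : ∀ x, idx x₁ = idx x + 1 → ∀ e : x ⟶ x₁,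
      ψ ∘ₗ V.map e = φ x ∧ (a ≤ idx x → V.map e (v x) = w))
    (hout : ∀ y, idx x₁ = idx y + 1 → ∀ e : x₁ ⟶ y,
      V.map e w = v y ∧ (a ≤ idx y → φ y ∘ₗ V.map e = ψ)) :
    ∃ v' φ', IsSummandOn V (interval τ 0 (idx x₁ + 1)) (interval τ a (idx x₁ + 1)) v' φ' ∧
      v' x₁ = w ∧ φ' x₁ = ψ := by
  have hloop : IsEmpty (x₁ ⟶ x₁) := ⟨fun e => by rcases arrow_cases e with h | h <;> omega⟩
  have hsucc : ∀ x ∈ interval τ 0 (idx x₁), (x ⟶ x₁) → idx x₁ = idx x + 1 := fun x hx e =>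
    (arrow_cases e).elim And.left fun h => absurd hx.2 (by omega)
  have hsucc' : ∀ y ∈ interval τ 0 (idx x₁), (x₁ ⟶ y) → idx x₁ = idx y + 1 := fun y hy e =>
    (arrow_cases e).elim (fun h => absurd hy.2 (by omega)) And.left
  rw [interval_idx_succ (Nat.zero_le _), interval_idx_succ ha]
  exact h.exists_insert (fun x hx => ⟨Nat.zero_le _, hx.2⟩) (fun hx => lt_irrefl _ hx.2) hloop hψw
    (fun x hx e => (hin x (hsucc x hx e) e).imp_right fun h hx => h hx.1)
    (fun y hy e => (hout y (hsucc' y hy e) e).imp_right fun h hy => h hy.1)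

theorem exists_isSummandOn_of_forward (e : x₀ ⟶ x₁) (hx : idx x₁ = idx x₀ + 1)
    (h : IsSummandOn V (interval τ 0 (idx x₁)) (interval τ a (idx x₁)) v φ) (ha : a ≤ idx x₁)
    (hψw : ψ w = 1) (hψ : ψ ∘ₗ V.map e = φ x₀) (hw : a ≤ idx x₀ → V.map e (v x₀) = w) :
    ∃ v' φ', IsSummandOn V (interval τ 0 (idx x₁ + 1)) (interval τ a (idx x₁ + 1)) v' φ' ∧
      v' x₁ = w ∧ φ' x₁ = ψ := by
  refine exists_isSummandOn_succ h ha hψw (fun x hx' e' => ?_) fun y hy e' => ?_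
  · obtain rfl := idx_injective (show idx x₀ = idx x by omega)
    exact Subsingleton.elim e e' ▸ ⟨hψ, hw⟩
  · obtain rfl := idx_injective (show idx x₀ = idx y by omega)
    rcases arrow_cases e with ⟨-, hf⟩ | ⟨h, -⟩ <;> rcases arrow_cases e' with ⟨h', -⟩ | ⟨-, hb⟩
    exacts [by omega, (hf.not_isBackward hb).elim, by omega, by omega]

theorem exists_isSummandOn_of_backward (e : x₁ ⟶ x₀) (hx : idx x₁ = idx x₀ + 1)
    (h : IsSummandOn V (interval τ 0 (idx x₁)) (interval τ a (idx x₁)) v φ) (ha : a ≤ idx x₁)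
    (hψw : ψ w = 1) (hw : V.map e w = v x₀) (hψ : a ≤ idx x₀ → φ x₀ ∘ₗ V.map e = ψ) :
    ∃ v' φ', IsSummandOn V (interval τ 0 (idx x₁ + 1)) (interval τ a (idx x₁ + 1)) v' φ' ∧
      v' x₁ = w ∧ φ' x₁ = ψ := by
  refine exists_isSummandOn_succ h ha hψw (fun x hx' e' => ?_) fun y hy e' => ?_
  · obtain rfl := idx_injective (show idx x₀ = idx x by omega)
    rcases arrow_cases e with ⟨h, -⟩ | ⟨-, hb⟩ <;> rcases arrow_cases e' with ⟨-, hf⟩ | ⟨h', -⟩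
    exacts [by omega, by omega, (hf.not_isBackward hb).elim, by omega]
  · obtain rfl := idx_injective (show idx x₀ = idx y by omega)
    exact Subsingleton.elim e e' ▸ ⟨hw, hψ⟩

theorem isSummandOn_interval_self (V : QuiverRep K (TypeA τ)) (Y : Set (TypeA τ)) (n : ℕ) :
    IsSummandOn V Y (interval τ n n) 0 0 := by
  rw [interval_self]
  exact isSummandOn_empty V Y

/-- Every strict inclusion `Z < R` of subspaces of `V` at `x` is detected by an interval summand of
the restriction of `V` to the vertices up to `x`: its vector at `x` lies in `R`, and its functional
at `x` vanishes on `Z`. -/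
def SeparatesAt (V : QuiverRep K (TypeA τ)) (x : TypeA τ) : Prop :=
  ∀ Z R : Submodule K (V.obj x), Z < R → ∃ a ≤ idx x, ∃ v φ,
    IsSummandOn V (interval τ 0 (idx x + 1)) (interval τ a (idx x + 1)) v φ ∧
      v x ∈ R ∧ Z ≤ LinearMap.ker (φ x)

theorem separatesAt_of_idx_eq_zero (hx : idx x₁ = 0) : SeparatesAt V x₁ := by
  intro Z R hZR
  obtain ⟨w, hwR, hwZ⟩ := SetLike.exists_of_lt hZR
  obtain ⟨ψ, hψZ, hψw⟩ := exists_dual_eq_one Z hwZ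
  obtain ⟨v, φ, hS, rfl, rfl⟩ :=
    exists_isSummandOn_succ (isSummandOn_interval_self V _ (idx x₁)) le_rfl hψw
      (fun x hx => by omega) fun y hy => by omega
  exact ⟨_, le_rfl, v, φ, hS, hwR, hψZ⟩

theorem SeparatesAt.of_forward (h₀ : SeparatesAt V x₀) (e : x₀ ⟶ x₁)
    (hx : idx x₁ = idx x₀ + 1) : SeparatesAt V x₁ := by
  intro Z R hZR
  by_cases hle : R.comap (V.map e) ≤ Z.comap (V.map e)
  · obtain ⟨w, hwR, ψ, hψZ, hψ, hψw⟩ := exists_dual_comp_eq_zero_of_comap_le _ hZR hle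
    obtain ⟨v, φ, hS, rfl, rfl⟩ := exists_isSummandOn_of_forward e hx
      (isSummandOn_interval_self V _ (idx x₁)) le_rfl hψw hψ fun h => by omega
    exact ⟨_, le_rfl, v, φ, hS, hwR, hψZ⟩
  · obtain ⟨a, ha, v₀, φ₀, hS₀, hvR, hφZ⟩ :=
      h₀ _ _ (lt_of_le_not_ge (Submodule.comap_mono hZR.le) hle)
    obtain ⟨ψ, hψZ, hψ⟩ := exists_dual_comp_eq (V.map e) Z (φ₀ x₀) hφZ
    have hψw : ψ (V.map e (v₀ x₀)) = 1 := (LinearMap.congr_fun hψ _).trans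
      (hS₀.coord_vec x₀ ⟨ha, Nat.lt_succ_self _⟩)
    obtain ⟨v, φ, hS, hv, rfl⟩ := exists_isSummandOn_of_forward e hx (hx ▸ hS₀) (by omega)
      hψw hψ fun _ => rfl
    exact ⟨a, by omega, v, φ, hS, hv ▸ hvR, hψZ⟩

theorem SeparatesAt.of_backward (h₀ : SeparatesAt V x₀) (e : x₁ ⟶ x₀)
    (hx : idx x₁ = idx x₀ + 1) : SeparatesAt V x₁ := by
  intro Z R hZR
  by_cases hle : R.map (V.map e) ≤ Z.map (V.map e)
  · obtain ⟨w, hwR, hw, ψ, hψZ, hψw⟩ := exists_dual_of_map_le _ hZR hle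
    obtain ⟨v, φ, hS, rfl, rfl⟩ := exists_isSummandOn_of_backward e hx
      (isSummandOn_interval_self V _ (idx x₁)) le_rfl hψw hw fun h => by omega
    exact ⟨_, le_rfl, v, φ, hS, hwR, hψZ⟩
  · obtain ⟨a, ha, v₀, φ₀, hS₀, ⟨w, hwR, hw⟩, hφZ⟩ :=
      h₀ _ _ (lt_of_le_not_ge (Submodule.map_mono hZR.le) hle)
    have hψw : (φ₀ x₀ ∘ₗ V.map e) w = 1 := (congrArg (φ₀ x₀) hw).trans
      (hS₀.coord_vec x₀ ⟨ha, Nat.lt_succ_self _⟩)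
    obtain ⟨v, φ, hS, rfl, hφ⟩ := exists_isSummandOn_of_backward e hx (hx ▸ hS₀) (by omega)
      hψw hw fun _ => rfl
    exact ⟨a, by omega, v, φ, hS, hwR, fun z hz => hφ ▸ hφZ ⟨z, hz, rfl⟩⟩

theorem separatesAt (V : QuiverRep K (TypeA τ)) (x : TypeA τ) : SeparatesAt V x := by
  induction hn : idx x generalizing x with
  | zero => exact separatesAt_of_idx_eq_zero hn
  | succ n ih =>
    have hlt := idx_lt x
    have hidx : idx (vertexAt τ n) = n := idx_vertexAt (by omega)
    have hx : idx x = idx (vertexAt τ n) + 1 := by rw [hidx, hn]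
    rcases isForward_or_isBackward (τ := τ) (c := idx (vertexAt τ n)) (by omega) with hc | hc
    · obtain ⟨e⟩ := hc.nonempty_hom hx
      exact (ih _ hidx).of_forward e hx
    · obtain ⟨e⟩ := hc.nonempty_hom hx
      exact (ih _ hidx).of_backward e hx

theorem exists_isSummand (hV : V.IsNonzero) :
    ∃ a b v φ, a < b ∧ b ≤ ℓ + 1 ∧ IsSummand V (interval τ a b) v φ := by
  classical
  obtain ⟨x, hx⟩ := hV
  obtain ⟨x₁, hx₁, hmax⟩ := Finset.exists_max_image
    (Finset.univ.filter fun x => Nontrivial (V.obj x)) idx ⟨x, (Finset.mem_filter_univ x).2 hx⟩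
  have := (Finset.mem_filter_univ x₁).1 hx₁
  obtain ⟨a, ha, v, φ, hS, -, -⟩ := separatesAt V x₁ ⊥ ⊤ bot_lt_top
  refine ⟨a, _, v, φ, Nat.lt_succ_of_le ha, idx_lt x₁, hS.isSummand fun x hx => ?_⟩
  rw [← not_nontrivial_iff_subsingleton]
  exact fun hnt => hx ⟨Nat.zero_le _, Nat.lt_succ_of_le (hmax x ((Finset.mem_filter_univ x).2 hnt))⟩

/-- A decomposition of `V` into interval modules, of the intervals `[lo j, hi j)`. -/
structure IntervalDecomp (V : QuiverRep K (TypeA τ)) (J : Type) [Fintype J] extends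
    ThinDecomp V J where
  /-- the first index of an interval -/
  lo : J → ℕ
  /-- the index after the last of an interval -/
  hi : J → ℕ
  lo_lt_hi : ∀ j, lo j < hi j
  hi_le : ∀ j, hi j ≤ ℓ + 1
  supp_eq : ∀ j, supp j = interval τ (lo j) (hi j)

theorem exists_intervalDecomp (V : QuiverRep K (TypeA τ)) :
    ∃ (J : Type) (_ : Fintype J), Nonempty (IntervalDecomp V J) := by
  induction hn : ∑ x, V.dimVec x using Nat.strong_induction_on generalizing V with | _ n ih
  by_cases hV : V.IsNonzero
  · obtain ⟨a, b, v, φ, hab, hb, h⟩ := exists_isSummand hV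
    have hlt : ∑ x, h.compl.toRep.dimVec x < n := by
      rw [← hn, ← h.thinVec_add_dimVec_compl]
      have hpos := thinVec_of_mem (vertexAt_mem_interval (τ := τ) hb le_rfl hab)
      exact Finset.sum_lt_sum (fun x _ => Nat.le_add_left _ _)
        ⟨_, Finset.mem_univ _, Nat.lt_add_of_pos_left (hpos.symm ▸ Nat.one_pos)⟩
    obtain ⟨J, hJ, ⟨D⟩⟩ := ih _ hlt h.compl.toRep rfl
    exact ⟨Option J, inferInstance,
      ⟨{ h.decomp D.toThinDecomp with
        lo := fun j => j.elim a D.lo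
        hi := fun j => j.elim b D.hi
        lo_lt_hi := fun | none => hab | some j => D.lo_lt_hi j
        hi_le := fun | none => hb | some j => D.hi_le j
        supp_eq := fun | none => rfl | some j => D.supp_eq j }⟩⟩
  · have hsub : ∀ x, Subsingleton (V.obj x) := fun x =>
      not_nontrivial_iff_subsingleton.1 fun h => hV ⟨x, h⟩
    exact ⟨Empty, inferInstance,
      ⟨{ ThinDecomp.ofSubsingleton hsub with
        lo := Empty.elim
        hi := Empty.elim
        lo_lt_hi := fun j => j.elim
        hi_le := fun j => j.elim
        supp_eq := fun j => j.elim }⟩⟩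

end TypeA

/-! ### Totally stable central charges are complete -/

namespace TypeA

open QuiverRep QuiverRep.Subrep

variable {ℓ : ℕ} {τ : Fin ℓ → Bool} {α : TypeA τ → ℝ} {a b c : ℕ}

theorem TotallyStable.bulge_ne_zero (hα : TotallyStable α) (hac : a < c) (hcb : c < b)
    (hb : b ≤ ℓ + 1) : bulge (height α) a c b ≠ 0 := by
  obtain ⟨c, rfl⟩ := Nat.exists_eq_add_one_of_ne_zero (Nat.ne_zero_of_lt hac)
  have hstable := hα a b hb c (by omega) hcb
  rcases isForward_or_isBackward (τ := τ) (c := c) (by omega) with hc | hc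
  exacts [(hstable.1 hc).ne', (hstable.2 hc).ne]

theorem TotallyStable.chordSlope_left_injective (hα : TotallyStable α) (hac : a < c) (hab : a < b)
    (hc : c ≤ ℓ + 1) (hb : b ≤ ℓ + 1)
    (h : chordSlope (height α) a c = chordSlope (height α) a b) : c = b := by
  rcases lt_trichotomy c b with hcb | hcb | hcb
  · exact (hα.bulge_ne_zero hac hcb hb ((bulge_eq_zero_iff_chordSlope_left_eq hac hcb).2 h)).elim
  · exact hcb
  · exact (hα.bulge_ne_zero hab hcb hc
      ((bulge_eq_zero_iff_chordSlope_left_eq hab hcb).2 h.symm)).elim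

theorem TotallyStable.chordSlope_ne_chordSlope (hα : TotallyStable α) (hac : a < c) (hcb : c < b)
    (hb : b ≤ ℓ + 1) : chordSlope (height α) a c ≠ chordSlope (height α) c b :=
  fun h => hα.bulge_ne_zero hac hcb hb ((bulge_eq_zero_iff hac hcb).2 h)

variable {K : Type u} [Field K] {V W : QuiverRep K (TypeA τ)} {J J' : Type} [Fintype J]
  [Fintype J']

namespace IntervalDecomp

/-- The slope of the summand `j`. -/
def mean (D : IntervalDecomp V J) (α : TypeA τ → ℝ) (j : J) : ℝ :=
  chordSlope (height α) (D.lo j) (D.hi j)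

theorem mem_supp_iff (D : IntervalDecomp V J) {j : J} {x : TypeA τ} :
    x ∈ D.supp j ↔ D.lo j ≤ idx x ∧ idx x < D.hi j := by
  rw [D.supp_eq]
  exact Iff.rfl

theorem semistableBetween_line (D : IntervalDecomp V J) (hα : TotallyStable α) (j : J) :
    SemistableBetween α (D.mean α j) ⊥ (D.isSummand j).line := by
  refine (hα _ _ (D.hi_le j)).semistableBetween (D.lo_lt_hi j) (D.hi_le j) bot_le ?_ ?_
  · rw [IsSummand.dimVec_line, D.supp_eq, dimVec_bot, add_zero]
  · rintro x - y hy e v hv hvy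
    obtain ⟨t, rfl⟩ := Submodule.mem_span_singleton.1 hv
    have hcoord : D.coord j x (t • D.vec j x) = 0 := by
      rw [← (D.isSummand j).coord_map e (D.supp_eq j ▸ hy), (Submodule.mem_bot K).1 hvy, map_zero]
    by_cases hx : x ∈ D.supp j
    · rw [map_smul, (D.isSummand j).coord_vec x hx, smul_eq_mul, mul_one] at hcoord
      rw [hcoord, zero_smul]
      exact zero_mem _
    · rw [(D.isSummand j).vec_eq_zero x hx, smul_zero]
      exact zero_mem _

theorem semistableBetween_compl (D : IntervalDecomp V J) (hα : TotallyStable α) (j : J) :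
    SemistableBetween α (D.mean α j) (D.isSummand j).compl ⊤ := by
  refine (hα _ _ (D.hi_le j)).semistableBetween (D.lo_lt_hi j) (D.hi_le j) le_top ?_ ?_
  · rw [dimVec_top, ← D.supp_eq j]
    exact (D.isSummand j).thinVec_add_dimVec_compl.symm
  · rintro x - y hy e v - hvy
    exact ((D.isSummand j).coord_map e (D.supp_eq j ▸ hy) v).symm.trans hvy

open Classical in
theorem card_mean_mem_eq (D : IntervalDecomp V J) (hα : TotallyStable α)
    {T : List (TypeA τ → ℕ)} (hT : V.IsHNType α T) {U : Set ℝ} (hU : IsUpperSet U)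
    (x : TypeA τ) :
    Finset.card {j | D.mean α j ∈ U ∧ x ∈ D.supp j} =
      (T.map fun d => if dimSlope α d ∈ U then d else 0).sum x := by
  obtain ⟨R, hR, hRle, hleR⟩ := hT.exists_truncation hU
  rw [← hR]
  exact (D.finrank_eq_card
    (fun j hj => hleR _ hj _ (D.semistableBetween_line hα j) x
      (Submodule.mem_span_singleton_self _))
    fun j hj => hRle _ hj _ (D.semistableBetween_compl hα j) x).symm

open Classical in
theorem card_mean_eq_add (D : IntervalDecomp V J) (α : TypeA τ → ℝ) {μ : ℝ} {U U' : Set ℝ}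
    (hμ : μ ∉ U) (hU : insert μ U = U') (x : TypeA τ) :
    Finset.card {j | D.mean α j ∈ U' ∧ x ∈ D.supp j} =
      Finset.card {j | D.mean α j = μ ∧ x ∈ D.supp j} +
        Finset.card {j | D.mean α j ∈ U ∧ x ∈ D.supp j} := by
  rw [← Finset.card_union_of_disjoint, ← Finset.filter_or]
  · simp only [← hU, Set.mem_insert_iff, or_and_right]
  · exact Finset.disjoint_filter.2 fun j _ h h' => hμ (h.1 ▸ h'.1)

open Classical in
theorem card_mean_eq_of_isHNType (D : IntervalDecomp V J) (D' : IntervalDecomp W J')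
    (hα : TotallyStable α) {T : List (TypeA τ → ℕ)} (hV : V.IsHNType α T) (hW : W.IsHNType α T)
    (μ : ℝ) (x : TypeA τ) :
    Finset.card {j | D.mean α j = μ ∧ x ∈ D.supp j} =
      Finset.card {j | D'.mean α j = μ ∧ x ∈ D'.supp j} := by
  have hIci := (D.card_mean_mem_eq hα hV (isUpperSet_Ici μ) x).trans
    (D'.card_mean_mem_eq hα hW (isUpperSet_Ici μ) x).symm
  have hIoi := (D.card_mean_mem_eq hα hV (isUpperSet_Ioi μ) x).trans
    (D'.card_mean_mem_eq hα hW (isUpperSet_Ioi μ) x).symm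
  rw [D.card_mean_eq_add α Set.self_notMem_Ioi Set.Ioi_insert,
    D'.card_mean_eq_add α Set.self_notMem_Ioi Set.Ioi_insert, hIoi] at hIci
  exact Nat.add_right_cancel hIci

open Classical in
/-- Among the summands with the slope of `[a, b)`, none ends at `a` and only `[a, b)` starts
there. -/
theorem card_mean_eq_add_card_interval (D : IntervalDecomp V J) (hα : TotallyStable α)
    (hab : a < b) (hb : b ≤ ℓ + 1) :
    Finset.card {j | D.mean α j = chordSlope (height α) a b ∧ vertexAt τ a ∈ D.supp j} =
      Finset.card {j | D.mean α j = chordSlope (height α) a b ∧ D.lo j < a ∧ a ≤ D.hi j} +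
        Finset.card {j | (D.lo j, D.hi j) = (a, b)} := by
  have ha : idx (vertexAt τ a) = a := idx_vertexAt (by omega)
  simp only [D.mem_supp_iff, ha, Prod.mk.injEq]
  rw [← Finset.card_union_of_disjoint, ← Finset.filter_or]
  · refine congrArg Finset.card (Finset.filter_congr fun j _ => ⟨?_, ?_⟩)
    · rintro ⟨hμ, hlo, hhi⟩
      rcases hlo.lt_or_eq with hlo | rfl
      · exact Or.inl ⟨hμ, hlo, hhi.le⟩
      · exact Or.inr ⟨rfl, hα.chordSlope_left_injective hhi hab (D.hi_le j) hb hμ⟩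
    · rintro (⟨hμ, hlo, hhi⟩ | ⟨rfl, rfl⟩)
      · refine ⟨hμ, hlo.le, hhi.lt_of_ne ?_⟩
        rintro rfl
        exact hα.chordSlope_ne_chordSlope hlo hab hb hμ
      · exact ⟨rfl, le_rfl, hab⟩
  · exact Finset.disjoint_filter.2 fun j _ h h' => h.2.1.ne h'.1

open Classical in
theorem card_interval_eq_of_isHNType (D : IntervalDecomp V J) (D' : IntervalDecomp W J')
    (hα : TotallyStable α) {T : List (TypeA τ → ℕ)} (hV : V.IsHNType α T) (hW : W.IsHNType α T)
    (hab : a < b) (hb : b ≤ ℓ + 1) :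
    Finset.card {j | (D.lo j, D.hi j) = (a, b)} =
      Finset.card {j | (D'.lo j, D'.hi j) = (a, b)} := by
  have hstart := D.card_mean_eq_of_isHNType D' hα hV hW (chordSlope (height α) a b) (vertexAt τ a)
  rw [D.card_mean_eq_add_card_interval hα hab hb, D'.card_mean_eq_add_card_interval hα hab hb]
    at hstart
  rcases a with _ | c
  · simpa only [Nat.not_lt_zero, false_and, and_false, Finset.filter_false, Finset.card_empty,
      zero_add] using hstart
  · have hcross := D.card_mean_eq_of_isHNType D' hα hV hW (chordSlope (height α) (c + 1) b)
      (vertexAt τ c)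
    simp only [mem_supp_iff, idx_vertexAt (show c < ℓ + 1 by omega)] at hcross
    simp only [Nat.lt_succ_iff, Nat.succ_le_iff] at hstart
    omega

theorem nonempty_fiber_equiv (D : IntervalDecomp V J) (D' : IntervalDecomp W J')
    (hα : TotallyStable α) {T : List (TypeA τ → ℕ)} (hV : V.IsHNType α T) (hW : W.IsHNType α T)
    (p : ℕ × ℕ) : Nonempty ({j // (D.lo j, D.hi j) = p} ≃ {j // (D'.lo j, D'.hi j) = p}) := by
  classical
  obtain ⟨a, b⟩ := p
  by_cases hp : a < b ∧ b ≤ ℓ + 1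
  · refine ⟨Fintype.equivOfCardEq ?_⟩
    rw [Fintype.card_subtype, Fintype.card_subtype]
    exact D.card_interval_eq_of_isHNType D' hα hV hW hp.1 hp.2
  · have hD : IsEmpty {j // (D.lo j, D.hi j) = (a, b)} :=
      ⟨fun ⟨j, hj⟩ => hp (by cases hj; exact ⟨D.lo_lt_hi j, D.hi_le j⟩)⟩
    have hD' : IsEmpty {j // (D'.lo j, D'.hi j) = (a, b)} :=
      ⟨fun ⟨j, hj⟩ => hp (by cases hj; exact ⟨D'.lo_lt_hi j, D'.hi_le j⟩)⟩
    exact ⟨Equiv.equivOfIsEmpty _ _⟩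

end IntervalDecomp

theorem TotallyStable.isCompleteCharge (hα : TotallyStable α) : IsCompleteCharge K α := by
  rintro V W ⟨T, hV, hW⟩
  obtain ⟨J, _, ⟨D⟩⟩ := exists_intervalDecomp V
  obtain ⟨J', _, ⟨D'⟩⟩ := exists_intervalDecomp W
  let E := fun p => (D.nonempty_fiber_equiv D' hα hV hW p).some
  refine D.isomorphic (D'.reindex (Equiv.ofFiberEquiv E)) fun j => ?_
  have hσ := Equiv.ofFiberEquiv_map E j
  obtain ⟨hlo, hhi⟩ := Prod.mk.inj hσ
  change D.supp j = D'.supp (Equiv.ofFiberEquiv E j)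
  rw [D.supp_eq, D'.supp_eq, hlo, hhi]

end TypeA

namespace TypeA

variable {ℓ : ℕ}

theorem isCompleteCharge_iff (K : Type u) [Field K] {τ : Fin ℓ → Bool} (α : TypeA τ → ℝ) :
    IsCompleteCharge K α ↔ TotallyStable α :=
  ⟨totallyStable_of_isCompleteCharge, TotallyStable.isCompleteCharge⟩

theorem height_increments (τ : Fin ℓ → Bool) (S : ℕ → ℝ) {i : ℕ} (hi : i ≤ ℓ + 1) :
    height (fun x : TypeA τ => S (idx x + 1) - S (idx x)) i = S i - S 0 := by
  rw [height, ← Finset.sum_range_sub]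
  refine Finset.sum_congr rfl fun j hj => ?_
  rw [idx_vertexAt ((Finset.mem_range.1 hj).trans_le hi)]

theorem exists_totallyStable (τ : Fin ℓ → Bool) : ∃ α : TypeA τ → ℝ, TotallyStable α := by
  let q : ℕ → ℝ := fun i => i * ((ℓ + 1 : ℕ) - i)
  -- heights on the parabola `q` over forward edges and on its mirror image elsewhere
  let S : ℕ → ℝ := fun i => if IsForward τ (i - 1) then q i else -q i
  let α : TypeA τ → ℝ := fun x => S (idx x + 1) - S (idx x)
  have hq : ∀ i ≤ ℓ + 1, 0 ≤ q i := fun i hi =>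
    mul_nonneg (Nat.cast_nonneg i) (sub_nonneg.2 (Nat.cast_le.2 hi))
  have hS : ∀ i ≤ ℓ + 1, S i ≤ q i ∧ -S i ≤ q i := fun i hi => by
    have := hq i hi
    simp only [S]
    split_ifs <;> constructor <;> linarith
  have hheight : ∀ i ≤ ℓ + 1, height α i = S i := fun i hi => by
    rw [height_increments τ S hi, sub_eq_self]
    simp [S, q]
  refine ⟨α, totallyStable_iff_aboveChords.2 ⟨aboveChords_of_le_parabola (fun i hi => ?_)
    fun c hc => ?_, aboveChords_of_le_parabola (fun i hi => ?_) fun c hc => ?_⟩⟩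
  · exact (hheight i hi).trans_le (hS i hi).1
  · exact (hheight (c + 1) (Nat.succ_le_succ hc.1.le)).trans (if_pos hc)
  · exact (congrArg Neg.neg (hheight i hi)).trans_le (hS i hi).2
  · rw [Pi.neg_apply, hheight (c + 1) (Nat.succ_le_succ hc.1.le), neg_eq_iff_eq_neg]
    exact if_neg fun hf => hf.not_isBackward hc

theorem totallyStable_iff_strictAnti {τ : Fin ℓ → Bool} (hτ : ∀ i, τ i = true)
    {α : TypeA τ → ℝ} : TotallyStable α ↔ StrictAnti α := by
  refine ⟨fun hα => Fin.strictAnti_iff_succ_lt.2 fun i => ?_, fun hα a b hb c hac hcb =>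
    ⟨fun _ => bulge_pos (by omega) hcb fun u v _ hu hv hvb => ?_, fun ⟨hc, hb⟩ => ?_⟩⟩
  · have hpos := (hα i (i + 2) (by omega) i le_rfl (by omega)).1 ⟨i.2, hτ i⟩
    have hchord : ∀ j : ℕ, chordSlope (height α) j (j + 1) = α (vertexAt τ j) := fun j => by
      rw [chordSlope, height_succ_sub, Nat.cast_succ, add_sub_cancel_left, div_one]
    rw [bulge_pos_iff (by omega) (by omega), hchord, hchord] at hpos
    have hi : vertexAt τ i = i.castSucc := vertexAt_idx (τ := τ) i.castSucc
    have hi' : vertexAt τ (i + 1) = i.succ := vertexAt_idx (τ := τ) i.succ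
    rwa [hi, hi'] at hpos
  · rw [height_succ_sub, height_succ_sub]
    refine hα (show idx _ < idx _ from ?_)
    rw [idx_vertexAt (by omega), idx_vertexAt (by omega)]
    omega
  · exact (Bool.false_ne_true (hb.symm.trans (hτ _))).elim

end TypeA

end

theorem theorem4p4 (K : Type u) [Field K] (ℓ : ℕ) (τ : Fin ℓ → Bool) :
    -- there is a complete central charge
    (∃ α : TypeA τ → ℝ, IsCompleteCharge K α) ∧
    -- the complete ones are exactly those which satisfy the two chains of inequalities
    (∀ α : TypeA τ → ℝ, IsCompleteCharge K α ↔
      (∀ k < TypeA.chi τ (TypeA.vertex τ (Fin.last ℓ)),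
        QuiverRep.slope α (TypeA.levelModule K (TypeA.chi τ) k) >
          QuiverRep.slope α (TypeA.levelModule K (TypeA.chi τ) (k + 1))) ∧
      (∀ k < TypeA.eta τ (TypeA.vertex τ (Fin.last ℓ)),
        QuiverRep.slope α (TypeA.levelModule K (TypeA.eta τ) k) <
          QuiverRep.slope α (TypeA.levelModule K (TypeA.eta τ) (k + 1)))) ∧
    -- the equioriented case
    ((∀ i, τ i = true) → ∀ α : TypeA τ → ℝ, IsCompleteCharge K α ↔
      ∀ i : Fin ℓ, α (TypeA.vertex τ i.castSucc) > α (TypeA.vertex τ i.succ)) := by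
  refine ⟨?_, fun α => ?_, fun hτ α => ?_⟩
  · obtain ⟨α, hα⟩ := TypeA.exists_totallyStable τ
    exact ⟨α, hα.isCompleteCharge⟩
  · rw [TypeA.isCompleteCharge_iff, TypeA.totallyStable_iff_slope_levelModule K]
  · rw [TypeA.isCompleteCharge_iff, TypeA.totallyStable_iff_strictAnti hτ]
    exact Fin.strictAnti_iff_succ_lt
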